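/- All spaces are complex. A finite-dimensional interpolation couple $[E_0,E_1]$ consists of two norms $\|\cdot\|_{E_0},\|\cdot\|_{E_1}$ on one finite-dimensional vector space $V$. For $0\le\theta\le1$ its complex interpolation space $E_\theta=[E_0,E_1]_\theta$ is $V$ with the norm $$\|x\|_{E_\theta}=\inf\Bigl\{\max\bigl(\sup_{t\in\mathbb R}\|f(it)\|_{E_0},\ \sup_{t\in\mathbb R}\|f(1+it)\|_{E_1}\bigr)\ :\ f(\theta)=x\Bigr\},$$ where $f$ runs through the bounded continuous functions from the closed strip $0\le\operatorname{Re}z\le1$ to $V$ that are holomorphic in its interior and for which $f(it)\to0$ and $f(1+it)\to0$ as $|t|\to\infty$. For an operator $T:E\to F$ between normed spaces and $1\le p\le\infty$ let $\pi_p(T)\in[0,\infty]$ be the infimum of all $\rho\ge0$ such that $$\Bigl(\sum_{i=1}^n\|Tx_i\|^p\Bigr)^{1/p}\le\rho\,\sup_{\|x'\|_{E'}\le1}\Bigl(\sum_{i=1}^n|\langle x',x_i\rangle|^p\Bigr)^{1/p}$$ for all $n$ and all $x_1,\dots,x_n\in E$ (with maxima instead of sums if $p=\infty$), and for $1\le p\le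 s\le\infty$ let $$\mu_{s,p}(T)=\sup\{\pi_p(ST)\ :\ Y\text{ a Banach space},\ S\in\mathcal L(F,Y),\ \pi_s(S)\le1\}$$ be the $(s,p)$-mixing norm of $T$. **Theorem.** Let $2\le s_0,s_1\le\infty$, $0\le\theta\le1$ and $1/s_\theta=(1-\theta)/s_0+\theta/s_1$. Let $[E_0,E_1]$ and $[F_0,F_1]$ be finite-dimensional interpolation couples on vector spaces $V$ and $W$. Then for every linear map $T:V\to W$ $$\mu_{s_\theta,2}(T:E_\theta\to F_\theta)\le d_\theta[E_0,E_1]\cdot\mu_{s_0,2}(T:E_0\to F_0)^{1-\theta}\cdot\mu_{s_1,2}(T:E_1\to F_1)^{\theta},$$ where, with $\mathcal L(\ell_2^m,E)$ carrying the operator norm (so that $[\mathcal L(\ell_2^m,E_0),\mathcal L(\ell_2^m,E_1)]$ is a finite-dimensional interpolation couple on the space of linear maps $\mathbb C^m\to V$), $$d_\theta[E_0,E_1]=\sup_{m}\bigl\|\mathcal L(\ell_2^m,E_\theta)\hookrightarrow[\mathcal L(\ell_2^m,E_0),\mathcal L(\ell_2^m,E_1)]_\theta\bigr\|.$$ -/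

import Mathlib

open Filter Topology
open scoped ENNReal NNReal

universe u v

noncomputable section

/-! ### Summing and mixing norms -/

/-- The weak `ℓ_p`-norm `sup_{x' ∈ B_{E'}} (∑ |⟨x', x_i⟩|^p)^{1/p}` of a finite family
(the maximum of the `|⟨x', x_i⟩|` if `p = ∞`). -/
def weakLpNorm {E : Type u} [NormedAddCommGroup E] [NormedSpace ℂ E] (p : ℝ≥0∞) {n : ℕ}
    (x : Fin n → E) : ℝ≥0∞ :=
  ⨆ (φ : StrongDual ℂ E) (_ : ‖φ‖ ≤ 1),
    ENNReal.ofReal ‖(WithLp.toLp p (fun i => φ (x i)) : PiLp p (fun _ : Fin n => ℂ))‖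

/-- The absolutely `(r,p)`-summing norm `π_{r,p}(T)`: the infimum of all admissible constants
(`∞` if there is none). -/
def summingNorm {E : Type u} {F : Type v} [NormedAddCommGroup E] [NormedSpace ℂ E]
    [NormedAddCommGroup F] [NormedSpace ℂ F] (r p : ℝ≥0∞) (T : E →L[ℂ] F) : ℝ≥0∞ :=
  ⨅ (ρ : ℝ≥0) (_ : ∀ (n : ℕ) (x : Fin n → E),
      ENNReal.ofReal ‖(WithLp.toLp r (fun i => T (x i)) : PiLp r (fun _ : Fin n => F))‖
        ≤ (ρ : ℝ≥0∞) * weakLpNorm p x), (ρ : ℝ≥0∞)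

/-- The `(s,p)`-mixing norm `μ_{s,p}(T) = sup {π_p(S T) | π_s(S) ≤ 1}`, where `S` runs through
the operators from `F` into arbitrary complex Banach spaces `Y`. -/
def mixingNorm {E : Type u} {F : Type v} [NormedAddCommGroup E] [NormedSpace ℂ E]
    [NormedAddCommGroup F] [NormedSpace ℂ F] (s p : ℝ≥0∞) (T : E →L[ℂ] F) : ℝ≥0∞ :=
  ⨆ (Y : Type v) (_ : NormedAddCommGroup Y) (_ : NormedSpace ℂ Y) (_ : CompleteSpace Y)
    (S : F →L[ℂ] Y) (_ : summingNorm s s S ≤ 1), summingNorm p p (S.comp T)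

/-! ### Norms on a fixed complex vector space -/

/-- A norm on the complex vector space `V`. Two norms on one finite-dimensional space `V` form a
finite-dimensional interpolation couple. -/
structure CNorm (V : Type u) [AddCommGroup V] [Module ℂ V] extends Seminorm ℂ V where
  eq_zero_of_apply_eq_zero : ∀ x : V, toSeminorm x = 0 → x = 0

namespace CNorm

variable {V : Type u} [AddCommGroup V] [Module ℂ V]

/-- The vector space `V` normed by `E`. -/
def Space (_E : CNorm V) : Type u := V

instance (E : CNorm V) : NormedAddCommGroup E.Space :=
  @AddGroupNorm.toNormedAddCommGroup V _
    { E.toSeminorm with eq_zero_of_map_eq_zero' := E.eq_zero_of_apply_eq_zero }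

instance (E : CNorm V) : NormedSpace ℂ E.Space where
  toModule := inferInstanceAs (Module ℂ V)
  norm_smul_le c x := (E.smul' c x).le

instance (E : CNorm V) [FiniteDimensional ℂ V] : FiniteDimensional ℂ E.Space :=
  inferInstanceAs (FiniteDimensional ℂ V)

/-- The identity of `V`, as a map into the normed space `E.Space`. -/
def toSpace (E : CNorm V) : V ≃ₗ[ℂ] E.Space := LinearEquiv.refl ℂ V

theorem norm_toSpace (E : CNorm V) (x : V) : ‖E.toSpace x‖ = E.toSeminorm x := rfl

/-- A linear map `T : V → W`, as an operator from `(V, E)` to `(W, F)`. -/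
def op {W : Type v} [AddCommGroup W] [Module ℂ W] [FiniteDimensional ℂ V]
    (T : V →ₗ[ℂ] W) (E : CNorm V) (F : CNorm W) : E.Space →L[ℂ] F.Space :=
  LinearMap.toContinuousLinearMap (F.toSpace.toLinearMap ∘ₗ T ∘ₗ E.toSpace.symm.toLinearMap)

/-- The norm of `L(ℓ_2^m, E)`, on the vector space of linear maps `ℂ^m → V`. -/
def hilbertOp (m : ℕ) (E : CNorm V) : CNorm (EuclideanSpace ℂ (Fin m) →ₗ[ℂ] V) where
  toSeminorm := Seminorm.of
    (fun S => ‖LinearMap.toContinuousLinearMap (E.toSpace.toLinearMap ∘ₗ S)‖)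
    (fun S S' => by
      rw [LinearMap.comp_add, map_add]
      exact norm_add_le _ _)
    (fun c S => by
      rw [LinearMap.comp_smul, map_smul]
      exact norm_smul _ _)
  eq_zero_of_apply_eq_zero S hS := by
    have h : LinearMap.toContinuousLinearMap (E.toSpace.toLinearMap ∘ₗ S) = 0 := norm_eq_zero.1 hS
    ext x : 1
    have hx := DFunLike.congr_fun h x
    exact hx

/-! ### The complex interpolation method -/

/-- Calderón's class of functions for the couple `[E₀, E₁]`: bounded and continuous on the closed
strip `0 ≤ re z ≤ 1`, holomorphic in its interior, and tending to zero at infinity on both boundary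
lines (in `E₀` on the left one, in `E₁` on the right one). As `V` is finite-dimensional, `E₀`, `E₁`
and `E₀ + E₁` have the same topology and the same bounded sets. -/
structure Admissible (E₀ E₁ : CNorm V) (f : ℂ → V) : Prop where
  diffContOnCl : DiffContOnCl ℂ (fun z => E₀.toSpace (f z)) (Complex.re ⁻¹' Set.Ioo 0 1)
  bounded : ∃ C : ℝ, ∀ z : ℂ, z.re ∈ Set.Icc (0 : ℝ) 1 → ‖E₀.toSpace (f z)‖ ≤ C
  tendsto_left : Tendsto (fun t : ℝ => E₀.toSpace (f (t * Complex.I))) (cocompact ℝ) (𝓝 0)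
  tendsto_right : Tendsto (fun t : ℝ => E₁.toSpace (f (1 + t * Complex.I))) (cocompact ℝ) (𝓝 0)

/-- The norm `max (sup_t ‖f(it)‖_{E₀}) (sup_t ‖f(1+it)‖_{E₁})` on Calderón's class. -/
def stripNorm (E₀ E₁ : CNorm V) (f : ℂ → V) : ℝ :=
  max (⨆ t : ℝ, E₀.toSeminorm (f (t * Complex.I)))
    (⨆ t : ℝ, E₁.toSeminorm (f (1 + t * Complex.I)))

/-- The interpolation norm `‖x‖_θ = inf {‖f‖ | f(θ) = x}`. -/
def interpFun (θ : unitInterval) (E₀ E₁ : CNorm V) (x : V) : ℝ :=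
  sInf (stripNorm E₀ E₁ '' {f | Admissible E₀ E₁ f ∧ f ((θ : ℝ) : ℂ) = x})

theorem stripNorm_nonneg (E₀ E₁ : CNorm V) (f : ℂ → V) : 0 ≤ stripNorm E₀ E₁ f :=
  le_max_of_le_left (Real.iSup_nonneg fun _ => apply_nonneg _ _)

theorem exists_le_mul [FiniteDimensional ℂ V] (E F : CNorm V) :
    ∃ C : ℝ, 0 ≤ C ∧ ∀ x, F.toSeminorm x ≤ C * E.toSeminorm x :=
  ⟨‖op LinearMap.id E F‖, norm_nonneg _, fun x => (op LinearMap.id E F).le_opNorm (E.toSpace x)⟩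

theorem Admissible.bddAbove_left {E₀ E₁ : CNorm V} {f : ℂ → V} (h : Admissible E₀ E₁ f) :
    BddAbove (Set.range fun t : ℝ => E₀.toSeminorm (f (t * Complex.I))) := by
  obtain ⟨C, hC⟩ := h.bounded
  refine ⟨C, ?_⟩
  rintro _ ⟨t, rfl⟩
  exact hC _ (by simp)

theorem Admissible.bddAbove_right [FiniteDimensional ℂ V] {E₀ E₁ : CNorm V} {f : ℂ → V}
    (h : Admissible E₀ E₁ f) :
    BddAbove (Set.range fun t : ℝ => E₁.toSeminorm (f (1 + t * Complex.I))) := by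
  obtain ⟨C, hC⟩ := h.bounded
  obtain ⟨D, hD0, hD⟩ := exists_le_mul E₀ E₁
  refine ⟨D * C, ?_⟩
  rintro _ ⟨t, rfl⟩
  exact (hD _).trans (mul_le_mul_of_nonneg_left (hC _ (by simp)) hD0)

theorem Admissible.le_left {E₀ E₁ : CNorm V} {f : ℂ → V} (h : Admissible E₀ E₁ f) (t : ℝ) :
    E₀.toSeminorm (f (t * Complex.I)) ≤ stripNorm E₀ E₁ f :=
  (le_ciSup h.bddAbove_left t).trans (le_max_left _ _)

theorem Admissible.le_right [FiniteDimensional ℂ V] {E₀ E₁ : CNorm V} {f : ℂ → V}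
    (h : Admissible E₀ E₁ f) (t : ℝ) :
    E₁.toSeminorm (f (1 + t * Complex.I)) ≤ stripNorm E₀ E₁ f :=
  (le_ciSup h.bddAbove_right t).trans (le_max_right _ _)

theorem Admissible.add {E₀ E₁ : CNorm V} {f g : ℂ → V} (hf : Admissible E₀ E₁ f)
    (hg : Admissible E₀ E₁ g) : Admissible E₀ E₁ (f + g) where
  diffContOnCl := by
    have := hf.diffContOnCl.add hg.diffContOnCl
    exact this
  bounded := by
    obtain ⟨C, hC⟩ := hf.bounded
    obtain ⟨D, hD⟩ := hg.bounded
    exact ⟨C + D, fun z hz => (norm_add_le _ _).trans (add_le_add (hC z hz) (hD z hz))⟩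
  tendsto_left := by simpa using hf.tendsto_left.add hg.tendsto_left
  tendsto_right := by simpa using hf.tendsto_right.add hg.tendsto_right

theorem Admissible.smul {E₀ E₁ : CNorm V} {f : ℂ → V} (hf : Admissible E₀ E₁ f) (c : ℂ) :
    Admissible E₀ E₁ (c • f) where
  diffContOnCl := by
    have := hf.diffContOnCl.const_smul c
    exact this
  bounded := by
    obtain ⟨C, hC⟩ := hf.bounded
    exact ⟨‖c‖ * C, fun z hz => (norm_smul_le c (E₀.toSpace (f z))).trans
      (mul_le_mul_of_nonneg_left (hC z hz) (norm_nonneg c))⟩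
  tendsto_left := by simpa using hf.tendsto_left.const_smul c
  tendsto_right := by simpa using hf.tendsto_right.const_smul c

theorem stripNorm_add_le [FiniteDimensional ℂ V] {E₀ E₁ : CNorm V} {f g : ℂ → V}
    (hf : Admissible E₀ E₁ f) (hg : Admissible E₀ E₁ g) :
    stripNorm E₀ E₁ (f + g) ≤ stripNorm E₀ E₁ f + stripNorm E₀ E₁ g :=
  max_le
    (ciSup_le fun t => (map_add_le_add _ _ _).trans (add_le_add (hf.le_left t) (hg.le_left t)))
    (ciSup_le fun t => (map_add_le_add _ _ _).trans (add_le_add (hf.le_right t) (hg.le_right t)))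

theorem stripNorm_smul_le [FiniteDimensional ℂ V] {E₀ E₁ : CNorm V} {f : ℂ → V}
    (hf : Admissible E₀ E₁ f) (c : ℂ) :
    stripNorm E₀ E₁ (c • f) ≤ ‖c‖ * stripNorm E₀ E₁ f :=
  max_le
    (ciSup_le fun t => (map_smul_eq_mul E₀.toSeminorm c _).trans_le
      (mul_le_mul_of_nonneg_left (hf.le_left t) (norm_nonneg c)))
    (ciSup_le fun t => (map_smul_eq_mul E₁.toSeminorm c _).trans_le
      (mul_le_mul_of_nonneg_left (hf.le_right t) (norm_nonneg c)))

theorem norm_exp_sq_sub_le (θ : ℝ) {z : ℂ} (hz : z.re ∈ Set.Icc (0 : ℝ) 1) :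
    ‖Complex.exp (z ^ 2 - (θ : ℂ) ^ 2)‖ ≤ Real.exp (1 - z.im ^ 2) := by
  rw [Complex.norm_exp]
  apply Real.exp_le_exp.2
  have h : (z ^ 2 - (θ : ℂ) ^ 2).re = z.re ^ 2 - z.im ^ 2 - θ ^ 2 := by
    simp [pow_two]
  rw [h]
  nlinarith [hz.1, hz.2, sq_nonneg θ]

theorem tendsto_exp_one_sub_sq :
    Tendsto (fun t : ℝ => Real.exp (1 - t ^ 2)) (cocompact ℝ) (𝓝 0) := by
  apply Real.tendsto_exp_atBot.comp
  have h : Tendsto (fun t : ℝ => t ^ 2) (cocompact ℝ) atTop := by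
    have := (tendsto_pow_atTop (two_ne_zero)).comp (tendsto_norm_cocompact_atTop (E := ℝ))
    refine this.congr fun t => ?_
    simp
  simpa [sub_eq_add_neg] using tendsto_atBot_add_const_left _ (1 : ℝ) (tendsto_neg_atTop_atBot.comp h)

theorem exists_admissible (θ : unitInterval) (E₀ E₁ : CNorm V) (x : V) :
    ∃ f, Admissible E₀ E₁ f ∧ f ((θ : ℝ) : ℂ) = x := by
  have key : ∀ (E : CNorm V) (a : ℝ), a ∈ Set.Icc (0 : ℝ) 1 →
      Tendsto (fun t : ℝ => E.toSpace
        (Complex.exp (((a : ℂ) + t * Complex.I) ^ 2 - ((θ : ℝ) : ℂ) ^ 2) • x))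
        (cocompact ℝ) (𝓝 0) := by
    intro E a ha
    have h := tendsto_exp_one_sub_sq.mul_const ‖E.toSpace x‖
    rw [zero_mul] at h
    refine squeeze_zero_norm (fun t => ?_) h
    rw [map_smul, norm_smul]
    refine mul_le_mul_of_nonneg_right ?_ (norm_nonneg _)
    have := norm_exp_sq_sub_le (θ : ℝ) (z := (a : ℂ) + t * Complex.I) (by simpa using ha)
    simpa using this
  refine ⟨fun z => Complex.exp (z ^ 2 - ((θ : ℝ) : ℂ) ^ 2) • x, ⟨?_, ?_, ?_, ?_⟩, by simp⟩
  · apply Differentiable.diffContOnCl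
    simp only [map_smul]
    fun_prop
  · refine ⟨Real.exp 1 * ‖E₀.toSpace x‖, fun z hz => ?_⟩
    rw [map_smul, norm_smul]
    refine mul_le_mul_of_nonneg_right ?_ (norm_nonneg _)
    refine (norm_exp_sq_sub_le (θ : ℝ) hz).trans (Real.exp_le_exp.2 ?_)
    nlinarith [sq_nonneg z.im]
  · simpa using key E₀ 0 (by simp)
  · simpa using key E₁ 1 (by simp)

theorem bddBelow_stripNorm (E₀ E₁ : CNorm V) (s : Set (ℂ → V)) :
    BddBelow (stripNorm E₀ E₁ '' s) := by
  refine ⟨0, ?_⟩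
  rintro _ ⟨f, -, rfl⟩
  exact stripNorm_nonneg E₀ E₁ f

theorem interpFun_le {θ : unitInterval} {E₀ E₁ : CNorm V} {f : ℂ → V}
    (hf : Admissible E₀ E₁ f) : interpFun θ E₀ E₁ (f ((θ : ℝ) : ℂ)) ≤ stripNorm E₀ E₁ f :=
  csInf_le (bddBelow_stripNorm _ _ _) ⟨f, ⟨hf, rfl⟩, rfl⟩

theorem exists_stripNorm_lt {θ : unitInterval} {E₀ E₁ : CNorm V} {x : V} {a : ℝ}
    (h : interpFun θ E₀ E₁ x < a) :
    ∃ f, Admissible E₀ E₁ f ∧ f ((θ : ℝ) : ℂ) = x ∧ stripNorm E₀ E₁ f < a := by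
  obtain ⟨f₀, hf₀⟩ := exists_admissible θ E₀ E₁ x
  obtain ⟨_, ⟨f, hf, rfl⟩, hfa⟩ := exists_lt_of_csInf_lt (Set.Nonempty.image _ ⟨f₀, hf₀⟩) h
  exact ⟨f, hf.1, hf.2, hfa⟩

theorem interpFun_nonneg (θ : unitInterval) (E₀ E₁ : CNorm V) (x : V) :
    0 ≤ interpFun θ E₀ E₁ x := by
  apply Real.sInf_nonneg
  rintro _ ⟨f, -, rfl⟩
  exact stripNorm_nonneg E₀ E₁ f

theorem interpFun_add_le [FiniteDimensional ℂ V] (θ : unitInterval) (E₀ E₁ : CNorm V) (x y : V) :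
    interpFun θ E₀ E₁ (x + y) ≤ interpFun θ E₀ E₁ x + interpFun θ E₀ E₁ y := by
  refine le_of_forall_pos_lt_add fun ε hε => ?_
  obtain ⟨f, hf, rfl, hfa⟩ := exists_stripNorm_lt (lt_add_of_pos_right (interpFun θ E₀ E₁ x)
    (half_pos hε))
  obtain ⟨g, hg, rfl, hga⟩ := exists_stripNorm_lt (lt_add_of_pos_right (interpFun θ E₀ E₁ y)
    (half_pos hε))
  have h₁ := interpFun_le (θ := θ) (hf.add hg)
  have h₂ := stripNorm_add_le hf hg
  simp only [Pi.add_apply] at h₁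
  linarith

theorem interpFun_smul_le [FiniteDimensional ℂ V] (θ : unitInterval) (E₀ E₁ : CNorm V) (c : ℂ)
    (x : V) : interpFun θ E₀ E₁ (c • x) ≤ ‖c‖ * interpFun θ E₀ E₁ x := by
  refine le_of_forall_pos_le_add fun ε hε => ?_
  have hc : 0 < ‖c‖ + 1 := by positivity
  obtain ⟨f, hf, rfl, hfa⟩ := exists_stripNorm_lt (lt_add_of_pos_right (interpFun θ E₀ E₁ x)
    (div_pos hε hc))
  have h₁ := interpFun_le (θ := θ) (hf.smul c)
  have h₂ := stripNorm_smul_le hf c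
  have h₃ : ‖c‖ * (ε / (‖c‖ + 1)) ≤ ε := by
    rw [mul_div_assoc', div_le_iff₀ hc]
    nlinarith [norm_nonneg c]
  have h₄ := mul_le_mul_of_nonneg_left hfa.le (norm_nonneg c)
  simp only [Pi.smul_apply] at h₁
  linarith

/-- The maximum principle on the strip. -/
theorem Admissible.apply_le [FiniteDimensional ℂ V] {E₀ E₁ : CNorm V} {f : ℂ → V}
    (hf : Admissible E₀ E₁ f) {C : ℝ} (hC : ∀ x, E₀.toSeminorm x ≤ C * E₁.toSeminorm x)
    (hC1 : 1 ≤ C) (θ : unitInterval) :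
    E₀.toSeminorm (f ((θ : ℝ) : ℂ)) ≤ C * stripNorm E₀ E₁ f := by
  have h0 := stripNorm_nonneg E₀ E₁ f
  obtain ⟨B, hB⟩ := hf.bounded
  have := PhragmenLindelof.vertical_strip (f := fun z => E₀.toSpace (f z)) (a := 0) (b := 1)
    (C := C * stripNorm E₀ E₁ f) (z := ((θ : ℝ) : ℂ)) hf.diffContOnCl
    ⟨0, by simpa using Real.pi_pos, 0, by
      refine Asymptotics.IsBigO.of_bound B ?_
      refine Filter.Eventually.filter_mono inf_le_right ?_
      rw [Filter.eventually_principal]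
      intro z hz
      simpa using hB z ⟨hz.1.le, hz.2.le⟩⟩
    (fun z hz => by
      have hz' : z = z.im * Complex.I := by apply Complex.ext <;> simp [hz]
      rw [hz', norm_toSpace]
      nlinarith [hf.le_left z.im])
    (fun z hz => by
      have hz' : z = 1 + z.im * Complex.I := by apply Complex.ext <;> simp [hz]
      rw [hz', norm_toSpace]
      exact (hC _).trans (mul_le_mul_of_nonneg_left (hf.le_right _) (by linarith)))
    (by simpa using θ.2.1) (by simpa using θ.2.2)
  exact this

theorem eq_zero_of_interpFun_eq_zero [FiniteDimensional ℂ V] (θ : unitInterval) (E₀ E₁ : CNorm V)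
    (x : V) (hx : interpFun θ E₀ E₁ x = 0) : x = 0 := by
  obtain ⟨D, hD0, hD⟩ := exists_le_mul E₁ E₀
  have hC : ∀ y, E₀.toSeminorm y ≤ (D + 1) * E₁.toSeminorm y := fun y => by
    nlinarith [hD y, apply_nonneg E₁.toSeminorm y]
  apply E₀.eq_zero_of_apply_eq_zero
  refine le_antisymm (le_of_forall_pos_le_add fun ε hε => ?_) (apply_nonneg _ _)
  have hD1 : 0 < D + 1 := by linarith
  obtain ⟨f, hf, rfl, hfa⟩ := exists_stripNorm_lt (hx.trans_lt (div_pos hε hD1))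
  have h := hf.apply_le hC (by linarith) θ
  rw [lt_div_iff₀ hD1] at hfa
  linarith

/-- The complex interpolation space `E_θ = [E₀, E₁]_θ`. -/
def interp [FiniteDimensional ℂ V] (θ : unitInterval) (E₀ E₁ : CNorm V) : CNorm V where
  toSeminorm := Seminorm.ofSMulLE (interpFun θ E₀ E₁)
    (le_antisymm (by simpa using interpFun_smul_le θ E₀ E₁ 0 0) (interpFun_nonneg _ _ _ _))
    (interpFun_add_le θ E₀ E₁) (interpFun_smul_le θ E₀ E₁)
  eq_zero_of_apply_eq_zero x hx := eq_zero_of_interpFun_eq_zero θ E₀ E₁ x hx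

/-- `d_θ[E₀, E₁] = sup_m ‖L(ℓ_2^m, E_θ) ↪ [L(ℓ_2^m, E₀), L(ℓ_2^m, E₁)]_θ‖`. -/
def dConst [FiniteDimensional ℂ V] (θ : unitInterval) (E₀ E₁ : CNorm V) : ℝ≥0∞ :=
  ⨆ m : ℕ, ENNReal.ofReal ‖op (LinearMap.id : (EuclideanSpace ℂ (Fin m) →ₗ[ℂ] V) →ₗ[ℂ] _)
    (hilbertOp m (interp θ E₀ E₁)) (interp θ (hilbertOp m E₀) (hilbertOp m E₁))‖

end CNorm

end

/-! Put κ = 1 - 1/s, so that q = 1/κ is the exponent conjugate to s, and κ is affine in 1/s. By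
duality μ_{s,2}(T) ≤ c is equivalent to `MixBound`: the bilinear maps (X, a) ↦ (T X a_j)_j from
L(ℓ_2^m, E) × ℓ_2^m(ℓ_q^n) to ℓ_q^n(F) have norm at most c for all m and n. In one direction
(`MixBound.of_mixingNorm_le`) the mixing norm is tested on diagonal operators S : F → ℓ_s^n built
from norming functionals. In the other (`MixBound.mixingNorm_le`) Pietsch domination replaces an
arbitrary S, on finitely many vectors and up to ε, by such a diagonal operator, and extremal
sequences for Hölder's inequality produce the family a.

The bilinear bound interpolates. For X in L(ℓ_2^m, E_θ), choose a Calderón function Z of the couple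
of operator spaces with Z(θ) = X and norm at most d_θ‖X‖ + ε; this is the only place where d_θ
enters. Extend a to an entire function whose norms in ℓ_2^m(ℓ_{q_0}^n) and ℓ_2^m(ℓ_{q_1}^n) on the
two lines do not exceed that of a (`exists_entire_lp`). After normalisation by a multiple of
c₀^{z-1} c₁^{-z}, the functions T Z(z) a_j(z) have ℓ_{q_i}(F_i)-norm at most 1 on the two lines, and
their value at θ has to be estimated in ℓ_q(F_θ).

That estimate is `interp_lp_le`. Each h_j is divided by a zero-free function exp(G_j), where re G_j
is close to log ‖h_j‖ on both lines. The quotient is almost bounded by 1, so ‖h_j(θ)‖_{F_θ} is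
almost at most |exp(G_j(θ))|, and a scalar three lines theorem with varying exponent
(`three_lines_lp`) controls the ℓ_q-norm of these moduli. The G_j come without solving a Dirichlet
problem: the strip is mapped to the disc, and the boundary data are approximated there by
trigonometric polynomials. -/

noncomputable section

/-! ### Harmonic approximation of boundary values on the strip -/

theorem closure_strip :
    closure (Complex.re ⁻¹' Set.Ioo (0 : ℝ) 1) = Complex.re ⁻¹' Set.Icc (0 : ℝ) 1 := by
  rw [Complex.closure_preimage_re, closure_Ioo zero_ne_one]

/-- The image under tanh of a compact set is compact and lies inside (-1, 1), so points close enough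
to x₀ avoid it. -/
theorem tendsto_artanh_cocompact {x₀ : ℝ} (hx₀ : x₀ ∉ Set.Ioo (-1 : ℝ) 1) :
    Tendsto Real.artanh (𝓝[Set.Ioo (-1) 1] x₀) (cocompact ℝ) := by
  rw [(hasBasis_cocompact).tendsto_right_iff]
  intro K hK
  have hc : IsCompact (Real.tanh '' K) := by
    refine hK.image ?_
    have : Real.tanh = fun x => Real.sinh x / Real.cosh x := by
      ext x; exact Real.tanh_eq_sinh_div_cosh x
    rw [this]
    exact Real.continuous_sinh.div Real.continuous_cosh fun x => (Real.cosh_pos x).ne'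
  have hmem : x₀ ∈ (Real.tanh '' K)ᶜ := by
    rintro ⟨t, -, rfl⟩
    exact hx₀ (Real.tanh_bijOn.mapsTo (Set.mem_univ t))
  have h1 : (Real.tanh '' K)ᶜ ∈ 𝓝[Set.Ioo (-1 : ℝ) 1] x₀ :=
    mem_nhdsWithin_of_mem_nhds (hc.isClosed.isOpen_compl.mem_nhds hmem)
  filter_upwards [h1, self_mem_nhdsWithin] with x hx hx' hxK
  exact hx ⟨_, hxK, Real.tanh_artanh hx'⟩

theorem continuousAt_artanh {x : ℝ} (hx : x ∈ Set.Ioo (-1 : ℝ) 1) :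
    ContinuousAt Real.artanh x := by
  have h1 : 0 < 1 - x := by linarith [hx.2]
  have h2 : 0 < 1 + x := by linarith [hx.1]
  have h3 : Real.sqrt ((1 + x) / (1 - x)) ≠ 0 := (Real.sqrt_pos.2 (div_pos h2 h1)).ne'
  unfold Real.artanh
  refine ContinuousAt.log ?_ h3
  refine Real.continuous_sqrt.continuousAt.comp ?_
  exact ContinuousAt.div (by fun_prop) (by fun_prop) h1.ne'

open Classical in
/-- A continuous function on the line with a limit at infinity, transported to `[-1, 1]`. -/
def artanhExtend (w : ℝ → ℝ) (L : ℝ) (x : ℝ) : ℝ :=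
  if x ∈ Set.Ioo (-1 : ℝ) 1 then w (Real.artanh x) else L

theorem artanhExtend_tanh (w : ℝ → ℝ) (L t : ℝ) : artanhExtend w L (Real.tanh t) = w t := by
  rw [artanhExtend, if_pos (Real.tanh_bijOn.mapsTo (Set.mem_univ t)), Real.artanh_tanh]

theorem artanhExtend_of_notMem (w : ℝ → ℝ) (L : ℝ) {x : ℝ} (hx : x ∉ Set.Ioo (-1 : ℝ) 1) :
    artanhExtend w L x = L := if_neg hx

/-- Continuity at ±1 is the limit of w at infinity; both ends carry the same L because the limit is
taken along `cocompact ℝ`. -/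
theorem continuous_artanhExtend {w : ℝ → ℝ} {L : ℝ} (hw : Continuous w)
    (hL : Tendsto w (cocompact ℝ) (𝓝 L)) : Continuous (artanhExtend w L) := by
  classical
  rw [continuous_iff_continuousAt]
  intro x₀
  by_cases hx₀ : x₀ ∈ Set.Ioo (-1 : ℝ) 1
  · have : artanhExtend w L =ᶠ[𝓝 x₀] fun x => w (Real.artanh x) := by
      filter_upwards [isOpen_Ioo.mem_nhds hx₀] with x hx
      exact if_pos hx
    exact (hw.continuousAt.comp (continuousAt_artanh hx₀)).congr this.symm
  · rw [ContinuousAt, artanhExtend_of_notMem w L hx₀]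
    exact Tendsto.if (hL.comp (tendsto_artanh_cocompact hx₀)) tendsto_const_nhds

/-- A conformal map of the strip onto the unit disc. -/
def stripToDisc (z : ℂ) : ℂ :=
  (Complex.exp (Real.pi * Complex.I * z) - Complex.I) /
    (Complex.exp (Real.pi * Complex.I * z) + Complex.I)

/-- The map z ↦ exp(πiz) sends the closed strip into the closed upper half-plane, which the Cayley
transform w ↦ (w - i)/(w + i) then sends into the closed disc. -/
theorem im_exp_nonneg {z : ℂ} (hz : z.re ∈ Set.Icc (0 : ℝ) 1) :
    0 ≤ (Complex.exp (Real.pi * Complex.I * z)).im := by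
  rw [Complex.exp_im]
  refine mul_nonneg (Real.exp_pos _).le ?_
  apply Real.sin_nonneg_of_nonneg_of_le_pi <;> simp
  · exact mul_nonneg Real.pi_pos.le hz.1
  · nlinarith [hz.2, Real.pi_pos]

theorem exp_add_I_ne_zero {z : ℂ} (hz : z.re ∈ Set.Icc (0 : ℝ) 1) :
    Complex.exp (Real.pi * Complex.I * z) + Complex.I ≠ 0 := by
  intro h
  have h1 := congrArg Complex.im h
  have h2 := im_exp_nonneg hz
  simp only [Complex.add_im, Complex.I_im, Complex.zero_im] at h1
  linarith

theorem differentiableOn_stripToDisc :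
    DifferentiableOn ℂ stripToDisc (Complex.re ⁻¹' Set.Icc (0 : ℝ) 1) := by
  unfold stripToDisc
  refine DifferentiableOn.div ?_ ?_ fun z hz => exp_add_I_ne_zero hz
  all_goals exact (by fun_prop : Differentiable ℂ _).differentiableOn

theorem norm_stripToDisc_le {z : ℂ} (hz : z.re ∈ Set.Icc (0 : ℝ) 1) : ‖stripToDisc z‖ ≤ 1 := by
  rw [stripToDisc, norm_div, div_le_one (norm_pos_iff.2 (exp_add_I_ne_zero hz))]
  refine (pow_le_pow_iff_left₀ (norm_nonneg _) (norm_nonneg _) two_ne_zero).1 ?_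
  have := im_exp_nonneg hz
  rw [← Complex.normSq_eq_norm_sq, ← Complex.normSq_eq_norm_sq, Complex.normSq_apply,
    Complex.normSq_apply]
  simp
  nlinarith

theorem cayley_ofReal (ζ : ℝ) : ((ζ : ℂ) - Complex.I) / (ζ + Complex.I) =
    ((ζ ^ 2 - 1) / (ζ ^ 2 + 1) : ℝ) + (-(2 * ζ) / (ζ ^ 2 + 1) : ℝ) * Complex.I := by
  have h1 : (ζ : ℂ) + Complex.I ≠ 0 := by
    intro h
    simpa using congrArg Complex.im h
  have h2 : (ζ ^ 2 + 1 : ℂ) ≠ 0 := by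
    have : (ζ ^ 2 + 1 : ℝ) ≠ 0 := by positivity
    exact_mod_cast this
  push_cast
  rw [div_eq_iff h1]
  field_simp
  ring_nf
  simp [Complex.I_sq]
  ring

/-- The left line goes to the lower open half-circle and, in `stripToDisc_right`, the right line to
the upper one, with the same real part tanh(-πt). On the circle the sign of the imaginary part thus
names the line and the real part gives the height t. -/
theorem stripToDisc_left (t : ℝ) : stripToDisc (t * Complex.I) =
    (Real.tanh (-(Real.pi * t)) : ℝ) + (-(1 / Real.cosh (Real.pi * t)) : ℝ) * Complex.I := by
  have h : Complex.exp (Real.pi * Complex.I * (t * Complex.I)) =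
      (Real.exp (-(Real.pi * t)) : ℝ) := by
    push_cast
    congr 1
    linear_combination (Real.pi * t : ℂ) * Complex.I_mul_I
  rw [stripToDisc, h, cayley_ofReal, Real.tanh_eq_sinh_div_cosh, Real.sinh_eq, Real.cosh_eq,
    Real.cosh_eq, neg_neg, Real.exp_neg]
  have := Real.exp_pos (Real.pi * t)
  refine congrArg₂ (fun a b : ℝ => (a : ℂ) + (b : ℂ) * Complex.I) ?_ ?_
  · field_simp
  · field_simp
    ring

theorem stripToDisc_right (t : ℝ) : stripToDisc (1 + t * Complex.I) =
    (Real.tanh (-(Real.pi * t)) : ℝ) + (1 / Real.cosh (Real.pi * t) : ℝ) * Complex.I := by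
  have h : Complex.exp (Real.pi * Complex.I * (1 + t * Complex.I)) =
      (-Real.exp (-(Real.pi * t)) : ℝ) := by
    push_cast
    have : (Real.pi * Complex.I * (1 + t * Complex.I) : ℂ) =
      Real.pi * Complex.I + -(Real.pi * t) := by
      linear_combination (Real.pi * t : ℂ) * Complex.I_mul_I
    rw [this, Complex.exp_add, Complex.exp_pi_mul_I]
    ring
  rw [stripToDisc, h, cayley_ofReal, Real.tanh_eq_sinh_div_cosh, Real.sinh_eq, Real.cosh_eq,
    Real.cosh_eq, neg_neg, Real.exp_neg]
  have := Real.exp_pos (Real.pi * t)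
  refine congrArg₂ (fun a b : ℝ => (a : ℂ) + (b : ℂ) * Complex.I) ?_ ?_
  · field_simp
  · field_simp
    ring

theorem tanh_sq_add_inv_cosh_sq (t : ℝ) :
    Real.tanh (-t) ^ 2 + (1 / Real.cosh t) ^ 2 = 1 := by
  have := Real.cosh_pos t
  rw [Real.tanh_neg, Real.tanh_eq_sinh_div_cosh]
  field_simp
  nlinarith [Real.cosh_sq t]

theorem norm_stripToDisc_left (t : ℝ) : ‖stripToDisc (t * Complex.I)‖ = 1 := by
  rw [stripToDisc_left, Complex.norm_add_mul_I, neg_sq, tanh_sq_add_inv_cosh_sq, Real.sqrt_one]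

theorem norm_stripToDisc_right (t : ℝ) : ‖stripToDisc (1 + t * Complex.I)‖ = 1 := by
  rw [stripToDisc_right, Complex.norm_add_mul_I, tanh_sq_add_inv_cosh_sq, Real.sqrt_one]

/-- Every trigonometric polynomial has the real part of an analytic polynomial. -/
theorem exists_polynomial_of_mem_span_fourier {T : ℝ} {p : C(AddCircle T, ℂ)}
    (hp : p ∈ Submodule.span ℂ (Set.range (@fourier T))) :
    ∃ P : Polynomial ℂ, ∀ x : AddCircle T, (p x).re = (P.eval (AddCircle.toCircle x : ℂ)).re := by
  -- Negative frequencies are conjugates of positive ones on the circle, and conjugation does not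
  -- change the real part.
  suffices h : ∃ P Q : Polynomial ℂ, ∀ x : AddCircle T, p x =
      P.eval (AddCircle.toCircle x : ℂ) + (starRingEnd ℂ) (Q.eval (AddCircle.toCircle x : ℂ)) by
    obtain ⟨P, Q, h⟩ := h
    exact ⟨P + Q, fun x => by simp [h]⟩
  induction hp using Submodule.span_induction with
  | mem f hf =>
    obtain ⟨n, rfl⟩ := hf
    obtain ⟨k, rfl | rfl⟩ := n.eq_nat_or_neg
    · refine ⟨Polynomial.X ^ k, 0, fun x => ?_⟩
      simp [fourier_apply, AddCircle.toCircle_nsmul]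
    · refine ⟨0, Polynomial.X ^ k, fun x => ?_⟩
      rw [fourier_neg]
      simp [fourier_apply, AddCircle.toCircle_nsmul]
  | zero => exact ⟨0, 0, fun x => by simp⟩
  | add f g _ _ hf hg =>
    obtain ⟨P, Q, h⟩ := hf
    obtain ⟨P', Q', h'⟩ := hg
    exact ⟨P + P', Q + Q', fun x => by simp [h, h']; ring⟩
  | smul c f _ hf =>
    obtain ⟨P, Q, h⟩ := hf
    exact ⟨Polynomial.C c * P, Polynomial.C (starRingEnd ℂ c) * Q, fun x => by simp [h]; ring⟩

/-- Continuous real boundary values on the two lines bounding the strip, with a common limit at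
infinity, are uniformly close to the real part of a bounded holomorphic function. -/
theorem exists_analytic_re_close {w₀ w₁ : ℝ → ℝ} {L : ℝ} (hw₀ : Continuous w₀)
    (hw₁ : Continuous w₁) (h₀ : Tendsto w₀ (cocompact ℝ) (𝓝 L))
    (h₁ : Tendsto w₁ (cocompact ℝ) (𝓝 L)) {ε : ℝ} (hε : 0 < ε) :
    ∃ G : ℂ → ℂ, DiffContOnCl ℂ G (Complex.re ⁻¹' Set.Ioo (0 : ℝ) 1) ∧
      (∃ C : ℝ, ∀ z : ℂ, z.re ∈ Set.Icc (0 : ℝ) 1 → ‖G z‖ ≤ C) ∧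
      (∀ t : ℝ, |(G (t * Complex.I)).re - w₀ t| ≤ ε) ∧
      ∀ t : ℝ, |(G (1 + t * Complex.I)).re - w₁ t| ≤ ε := by
  have hπ := Real.pi_pos
  have hcts : Continuous fun s : ℝ => -(s / Real.pi) := by fun_prop
  have hcoc : Tendsto (fun s : ℝ => -(s / Real.pi)) (cocompact ℝ) (cocompact ℝ) := by
    have : (fun s : ℝ => -(s / Real.pi)) =
        ((Homeomorph.mulRight₀ (-Real.pi⁻¹) (by simp [hπ.ne'])) : ℝ → ℝ) := by
      ext s
      simp [div_eq_mul_inv]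
    rw [this]
    exact (Homeomorph.isClosedEmbedding _).tendsto_cocompact
  -- The rescaling s ↦ -s/π undoes the argument -πt of tanh in the boundary values of `stripToDisc`.
  set v₀ := artanhExtend (fun s => w₀ (-(s / Real.pi))) L with hv₀
  set v₁ := artanhExtend (fun s => w₁ (-(s / Real.pi))) L with hv₁
  have hv₀c : Continuous v₀ := continuous_artanhExtend (hw₀.comp hcts) (h₀.comp hcoc)
  have hv₁c : Continuous v₁ := continuous_artanhExtend (hw₁.comp hcts) (h₁.comp hcoc)
  have hval₀ : ∀ t, v₀ (Real.tanh (-(Real.pi * t))) = w₀ t := fun t => by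
    rw [hv₀, artanhExtend_tanh]
    congr 1
    field_simp
  have hval₁ : ∀ t, v₁ (Real.tanh (-(Real.pi * t))) = w₁ t := fun t => by
    rw [hv₁, artanhExtend_tanh]
    congr 1
    field_simp
  have hWc : Continuous fun z : Circle => if (z : ℂ).im ≤ 0 then v₀ (z : ℂ).re
      else v₁ (z : ℂ).re := by
    refine Continuous.if_le (by fun_prop) (by fun_prop) (by fun_prop) (by fun_prop) ?_
    intro z hz
    -- The two arcs meet only at ±1, where both branches equal L; this is what the common limit at
    -- infinity is for.
    have h2 : (z : ℂ).re ∉ Set.Ioo (-1 : ℝ) 1 := by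
      intro h
      have h3 := Circle.normSq_coe z
      rw [Complex.normSq_apply, hz] at h3
      nlinarith [h.1, h.2]
    rw [hv₀, hv₁, artanhExtend_of_notMem _ _ h2, artanhExtend_of_notMem _ _ h2]
  have : Fact (0 < 2 * Real.pi) := ⟨by positivity⟩
  let W : C(AddCircle (2 * Real.pi), ℂ) :=
    ⟨fun x => ((if (AddCircle.toCircle x : ℂ).im ≤ 0 then v₀ (AddCircle.toCircle x : ℂ).re
      else v₁ (AddCircle.toCircle x : ℂ).re : ℝ) : ℂ),
      Complex.continuous_ofReal.comp (hWc.comp AddCircle.continuous_toCircle)⟩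
  have hW : W ∈ (Submodule.span ℂ (Set.range (@fourier (2 * Real.pi)))).topologicalClosure := by
    rw [span_fourier_closure_eq_top]
    trivial
  obtain ⟨p, hp, hpW⟩ := Metric.mem_closure_iff.1 hW ε hε
  obtain ⟨P, hP⟩ := exists_polynomial_of_mem_span_fourier hp
  have key : ∀ z : ℂ, ‖z‖ = 1 →
      |(P.eval z).re - (if z.im ≤ 0 then v₀ z.re else v₁ z.re)| ≤ ε := by
    intro z hz
    obtain ⟨x, hx⟩ := (AddCircle.homeomorphCircle (T := 2 * Real.pi) (by positivity)).surjective
      ⟨z, mem_sphere_zero_iff_norm.2 hz⟩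
    rw [AddCircle.homeomorphCircle_apply] at hx
    have hx' : (AddCircle.toCircle x : ℂ) = z := by rw [hx]
    have h3 := (ContinuousMap.dist_apply_le_dist x).trans hpW.le
    rw [dist_comm, dist_eq_norm] at h3
    have h4 := (Complex.abs_re_le_norm _).trans h3
    rw [Complex.sub_re, hP, hx'] at h4
    have h5 : (W x).re = if z.im ≤ 0 then v₀ z.re else v₁ z.re := by
      simp only [W, ContinuousMap.coe_mk, Complex.ofReal_re, hx']
    rwa [h5] at h4
  refine ⟨fun z => P.eval (stripToDisc z), ?_, ?_, fun t => ?_, fun t => ?_⟩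
  · apply DifferentiableOn.diffContOnCl
    rw [closure_strip]
    exact P.differentiable.comp_differentiableOn differentiableOn_stripToDisc
  · obtain ⟨C, hC⟩ := (isCompact_closedBall (0 : ℂ) 1).exists_bound_of_continuousOn
      (f := fun z => P.eval z) P.continuous.continuousOn
    exact ⟨C, fun z hz => hC _ (by simpa using norm_stripToDisc_le hz)⟩
  · have h := key _ (norm_stripToDisc_left t)
    have hpos : 0 < 1 / Real.cosh (Real.pi * t) := one_div_pos.2 (Real.cosh_pos _)
    have him : (stripToDisc (t * Complex.I)).im = -(1 / Real.cosh (Real.pi * t)) := by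
      rw [stripToDisc_left]
      simp only [Complex.add_im, Complex.ofReal_im, Complex.im_ofReal_mul, Complex.I_im, mul_one,
        zero_add]
    have hre : (stripToDisc (t * Complex.I)).re = Real.tanh (-(Real.pi * t)) := by
      rw [stripToDisc_left]
      simp only [Complex.add_re, Complex.ofReal_re, Complex.re_ofReal_mul, Complex.I_re, mul_zero,
        add_zero]
    rwa [if_pos (by rw [him]; linarith), hre, hval₀] at h
  · have h := key _ (norm_stripToDisc_right t)
    have hpos : 0 < 1 / Real.cosh (Real.pi * t) := one_div_pos.2 (Real.cosh_pos _)
    have him : (stripToDisc (1 + t * Complex.I)).im = 1 / Real.cosh (Real.pi * t) := by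
      rw [stripToDisc_right]
      simp only [Complex.add_im, Complex.ofReal_im, Complex.im_ofReal_mul, Complex.I_im, mul_one,
        zero_add]
    have hre : (stripToDisc (1 + t * Complex.I)).re = Real.tanh (-(Real.pi * t)) := by
      rw [stripToDisc_right]
      simp only [Complex.add_re, Complex.ofReal_re, Complex.re_ofReal_mul, Complex.I_re, mul_zero,
        add_zero]
    rwa [if_neg (by rw [him]; linarith), hre, hval₁] at h

/-! ### Interpolation of `ℓ_q`-sums -/

/-- The maximum principle for bounded holomorphic functions on the strip. -/
theorem norm_le_of_norm_le_on_boundary {X : Type*} [NormedAddCommGroup X] [NormedSpace ℂ X]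
    {f : ℂ → X} (hd : DiffContOnCl ℂ f (Complex.re ⁻¹' Set.Ioo (0 : ℝ) 1))
    (hb : ∃ B : ℝ, ∀ z : ℂ, z.re ∈ Set.Icc (0 : ℝ) 1 → ‖f z‖ ≤ B) {C : ℝ}
    (h₀ : ∀ t : ℝ, ‖f (t * Complex.I)‖ ≤ C) (h₁ : ∀ t : ℝ, ‖f (1 + t * Complex.I)‖ ≤ C)
    {z : ℂ} (hz : z.re ∈ Set.Icc (0 : ℝ) 1) : ‖f z‖ ≤ C := by
  obtain ⟨B, hB⟩ := hb
  refine PhragmenLindelof.vertical_strip (a := 0) (b := 1) hd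
    ⟨0, by simpa using Real.pi_pos, 0, ?_⟩ (fun w hw => ?_) (fun w hw => ?_) hz.1 hz.2
  · refine Asymptotics.IsBigO.of_bound B ?_
    refine Filter.Eventually.filter_mono inf_le_right ?_
    rw [Filter.eventually_principal]
    intro w hw
    simpa using hB w ⟨hw.1.le, hw.2.le⟩
  · have hw' : w = w.im * Complex.I := by apply Complex.ext <;> simp [hw]
    rw [hw']
    exact h₀ _
  · have hw' : w = 1 + w.im * Complex.I := by apply Complex.ext <;> simp [hw]
    rw [hw']
    exact h₁ _

/-- Hölder's inequality against powers of probability weights. -/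
theorem sum_mul_rpow_weight_le {ι : Type*} (s : Finset ι) {f β : ι → ℝ} (hf : ∀ i, 0 ≤ f i)
    (hβ : ∀ i, 0 < β i) (hsum : ∑ i ∈ s, β i = 1) {κ : ℝ} (hκ : κ ∈ Set.Ioc (0 : ℝ) 1) :
    ∑ i ∈ s, f i * β i ^ (1 - κ) ≤ (∑ i ∈ s, f i ^ (1 / κ)) ^ κ := by
  have h := Real.rpow_arith_mean_le_arith_mean_rpow s β (fun i => f i * β i ^ (-κ))
    (fun i _ => (hβ i).le) hsum (fun i _ => mul_nonneg (hf i) (Real.rpow_nonneg (hβ i).le _))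
    (p := 1 / κ) ((one_le_div hκ.1).2 hκ.2)
  have h1 : ∑ i ∈ s, β i * (f i * β i ^ (-κ)) = ∑ i ∈ s, f i * β i ^ (1 - κ) := by
    refine Finset.sum_congr rfl fun i _ => ?_
    rw [sub_eq_add_neg, Real.rpow_add (hβ i), Real.rpow_one]
    ring
  have h2 : ∑ i ∈ s, β i * (f i * β i ^ (-κ)) ^ (1 / κ) = ∑ i ∈ s, f i ^ (1 / κ) := by
    refine Finset.sum_congr rfl fun i _ => ?_
    rw [Real.mul_rpow (hf i) (Real.rpow_nonneg (hβ i).le _), ← Real.rpow_mul (hβ i).le,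
      neg_mul, mul_one_div_cancel hκ.1.ne', Real.rpow_neg_one]
    field_simp [(hβ i).ne']
  rw [h1, h2] at h
  have h0 : 0 ≤ ∑ i ∈ s, f i * β i ^ (1 - κ) :=
    Finset.sum_nonneg fun i _ => mul_nonneg (hf i) (Real.rpow_nonneg (hβ i).le _)
  have h3 := Real.rpow_le_rpow (Real.rpow_nonneg h0 _) h hκ.1.le
  rwa [← Real.rpow_mul h0, one_div_mul_cancel hκ.1.ne', Real.rpow_one] at h3

/-- The extremal weights in Hölder's inequality. -/
theorem sum_mul_extremal_weight {ι : Type*} (s : Finset ι) {γ : ι → ℝ} (hγ : ∀ i, 0 ≤ γ i)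
    {κ : ℝ} (hκ : κ ∈ Set.Ioc (0 : ℝ) 1) (hA : 0 < ∑ i ∈ s, γ i ^ (1 / κ)) :
    ∑ i ∈ s, γ i * (γ i ^ (1 / κ) / ∑ k ∈ s, γ k ^ (1 / κ)) ^ (1 - κ) =
      (∑ i ∈ s, γ i ^ (1 / κ)) ^ κ := by
  set A := ∑ i ∈ s, γ i ^ (1 / κ) with hAdef
  have h : ∀ i ∈ s, γ i * (γ i ^ (1 / κ) / A) ^ (1 - κ) = γ i ^ (1 / κ) / A ^ (1 - κ) := by
    intro i _
    rcases (hγ i).eq_or_lt with h0 | h0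
    · rw [← h0, Real.zero_rpow (one_div_pos.2 hκ.1).ne']
      simp
    · rw [Real.div_rpow (Real.rpow_nonneg h0.le _) hA.le, ← Real.rpow_mul h0.le, mul_div_assoc']
      congr 1
      nth_rewrite 1 [← Real.rpow_one (γ i)]
      rw [← Real.rpow_add h0]
      congr 1
      field_simp [hκ.1.ne']
      ring
  rw [Finset.sum_congr rfl h, ← Finset.sum_div, ← hAdef]
  nth_rewrite 1 [← Real.rpow_one A]
  rw [← Real.rpow_sub hA]
  congr 1
  ring

theorem re_interpolate (a b : ℝ) (z : ℂ) :
    ((1 - z) * (a : ℂ) + z * (b : ℂ)).re = (1 - z.re) * a + z.re * b := by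
  simp

/-- The three lines theorem for `ℓ_q`-valued functions with varying `q = 1 / κ`. -/
theorem three_lines_lp {n : ℕ} {g : Fin n → ℂ → ℂ}
    (hd : ∀ j, DiffContOnCl ℂ (g j) (Complex.re ⁻¹' Set.Ioo (0 : ℝ) 1))
    (hb : ∀ j, ∃ B : ℝ, ∀ z : ℂ, z.re ∈ Set.Icc (0 : ℝ) 1 → ‖g j z‖ ≤ B)
    {κ₀ κ₁ κ θ K : ℝ} (hκ₀ : κ₀ ∈ Set.Ioc (0 : ℝ) 1) (hκ₁ : κ₁ ∈ Set.Ioc (0 : ℝ) 1)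
    (hθ : θ ∈ Set.Icc (0 : ℝ) 1) (hκ : κ = (1 - θ) * κ₀ + θ * κ₁)
    (hκ' : κ ∈ Set.Ioc (0 : ℝ) 1)
    (h₀ : ∀ t : ℝ, (∑ j, ‖g j (t * Complex.I)‖ ^ (1 / κ₀)) ^ κ₀ ≤ K)
    (h₁ : ∀ t : ℝ, (∑ j, ‖g j (1 + t * Complex.I)‖ ^ (1 / κ₁)) ^ κ₁ ≤ K)
    (hne : ∀ j, g j θ ≠ 0) : (∑ j, ‖g j θ‖ ^ (1 / κ)) ^ κ ≤ K := by
  have hK : 0 ≤ K := (Real.rpow_nonneg (Finset.sum_nonneg fun j _ =>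
    Real.rpow_nonneg (norm_nonneg _) _) _).trans (h₀ 0)
  rcases isEmpty_or_nonempty (Fin n) with he | he
  · simpa [Real.zero_rpow hκ'.1.ne'] using hK
  set A := ∑ j, ‖g j θ‖ ^ (1 / κ) with hA
  have hApos : 0 < A :=
    Finset.sum_pos (fun j _ => Real.rpow_pos_of_pos (norm_pos_iff.2 (hne j)) _)
      Finset.univ_nonempty
  -- Duality reduces the claim to one scalar function: Φ(z) = ∑ g_j(z) e_j β_j^{1-κ(z)} with κ(z) =
  -- (1-z)κ₀ + zκ₁. The weights β_j are extremal at θ, where Φ takes exactly the value of the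
  -- ℓ_q-norm, and on the two lines Hölder's inequality bounds |Φ| by K. Nonvanishing of g_j(θ)
  -- makes log β_j meaningful.
  set β : Fin n → ℝ := fun j => ‖g j θ‖ ^ (1 / κ) / A with hβ
  have hβpos : ∀ j, 0 < β j := fun j =>
    div_pos (Real.rpow_pos_of_pos (norm_pos_iff.2 (hne j)) _) hApos
  have hβsum : ∑ j, β j = 1 := by
    rw [hβ, ← Finset.sum_div, ← hA, div_self hApos.ne']
  set e : Fin n → ℂ := fun j => (starRingEnd ℂ) (g j θ) / ‖g j θ‖ with he'
  have hen : ∀ j, ‖e j‖ = 1 := fun j => by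
    rw [he', norm_div, RCLike.norm_conj, Complex.norm_real, norm_norm,
      div_self (norm_ne_zero_iff.2 (hne j))]
  set E : Fin n → ℂ → ℂ := fun j z =>
    Complex.exp ((1 - ((1 - z) * κ₀ + z * κ₁)) * (Real.log (β j) : ℝ)) with hE
  have hEn : ∀ j z, ‖E j z‖ = β j ^ (1 - ((1 - z.re) * κ₀ + z.re * κ₁)) := fun j z => by
    rw [hE, Complex.norm_exp, Complex.re_mul_ofReal, Complex.sub_re, re_interpolate,
      Real.rpow_def_of_pos (hβpos j), Complex.one_re, mul_comm]
  set Φ : ℂ → ℂ := fun z => ∑ j, g j z * (e j * E j z) with hΦ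
  have hΦn : ∀ z, ‖Φ z‖ ≤ ∑ j, ‖g j z‖ * β j ^ (1 - ((1 - z.re) * κ₀ + z.re * κ₁)) := by
    intro z
    refine (norm_sum_le _ _).trans (le_of_eq (Finset.sum_congr rfl fun j _ => ?_))
    rw [norm_mul, norm_mul, hen, hEn, one_mul]
  have hΦθ : Φ θ = (A ^ κ : ℝ) := by
    rw [← sum_mul_extremal_weight Finset.univ (fun j => norm_nonneg (g j θ)) hκ' hApos, hΦ]
    push_cast
    refine Finset.sum_congr rfl fun j _ => ?_
    have h1 : E j θ = ((β j ^ (1 - κ) : ℝ) : ℂ) := by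
      rw [hE, Real.rpow_def_of_pos (hβpos j), hκ]
      push_cast
      congr 1
      ring
    have h2 : g j θ * e j = (‖g j θ‖ : ℝ) := by
      have := norm_ne_zero_iff.2 (hne j)
      rw [he', mul_div_assoc', Complex.mul_conj, Complex.normSq_eq_norm_sq]
      push_cast
      field_simp
    rw [← mul_assoc, h1, h2, hβ]
  have hmax : ‖Φ θ‖ ≤ K := by
    refine norm_le_of_norm_le_on_boundary ?_ ?_ (fun t => ?_) (fun t => ?_) (by simpa using hθ)
    · have hF : ∀ j, DiffContOnCl ℂ (fun z => g j z * (e j * E j z))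
          (Complex.re ⁻¹' Set.Ioo (0 : ℝ) 1) := fun j => by
        have hEd : Differentiable ℂ fun z => e j * E j z := by
          rw [hE]
          fun_prop
        exact (hd j).smul hEd.diffContOnCl
      refine ⟨?_, ?_⟩
      · rw [hΦ]
        exact DifferentiableOn.fun_sum fun j _ => (hF j).differentiableOn
      · exact continuousOn_finsetSum _ fun j _ => (hF j).continuousOn
    · choose B hB using hb
      refine ⟨∑ j, B j * 1, fun z hz => (hΦn z).trans ?_⟩
      refine Finset.sum_le_sum fun j _ => ?_
      refine mul_le_mul (hB j z hz) ?_ (Real.rpow_nonneg (hβpos j).le _)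
        ((norm_nonneg _).trans (hB j z hz))
      refine Real.rpow_le_one (hβpos j).le ?_ ?_
      · rw [← hβsum]
        exact Finset.single_le_sum (fun i _ => (hβpos i).le) (Finset.mem_univ j)
      · nlinarith [hz.1, hz.2, hκ₀.2, hκ₁.2]
    · refine (hΦn _).trans (le_trans ?_ (h₀ t))
      have := sum_mul_rpow_weight_le Finset.univ
        (fun j => norm_nonneg (g j (t * Complex.I))) hβpos hβsum hκ₀
      simpa using this
    · refine (hΦn _).trans (le_trans ?_ (h₁ t))
      have := sum_mul_rpow_weight_le Finset.univ
        (fun j => norm_nonneg (g j (1 + t * Complex.I))) hβpos hβsum hκ₁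
      simpa using this
  rw [hΦθ, Complex.norm_real] at hmax
  exact (le_abs_self _).trans hmax

/-! ### Calderón functions: multiplication by bounded scalar functions, continuity on the boundary
lines. -/

namespace CNorm

variable {V : Type u} [AddCommGroup V] [Module ℂ V]

theorem Admissible.mul_fun {E₀ E₁ : CNorm V} {f : ℂ → V} (hf : Admissible E₀ E₁ f) {g : ℂ → ℂ}
    (hg : DiffContOnCl ℂ g (Complex.re ⁻¹' Set.Ioo (0 : ℝ) 1))
    (hb : ∃ B : ℝ, ∀ z : ℂ, z.re ∈ Set.Icc (0 : ℝ) 1 → ‖g z‖ ≤ B) :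
    Admissible E₀ E₁ (fun z => g z • f z) := by
  obtain ⟨B, hB⟩ := hb
  have key : ∀ (E : CNorm V) (γ : ℝ → ℂ), (∀ t, (γ t).re ∈ Set.Icc (0 : ℝ) 1) →
      Tendsto (fun t : ℝ => E.toSpace (f (γ t))) (cocompact ℝ) (𝓝 0) →
      Tendsto (fun t : ℝ => E.toSpace (g (γ t) • f (γ t))) (cocompact ℝ) (𝓝 0) := by
    intro E γ hγ h
    have h' := h.norm.const_mul B
    rw [norm_zero, mul_zero] at h'
    refine squeeze_zero_norm (fun t => ?_) h'
    rw [map_smul, norm_smul]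
    exact mul_le_mul_of_nonneg_right (hB _ (hγ t)) (norm_nonneg _)
  refine ⟨?_, ?_, key E₀ _ (fun t => by simp) hf.tendsto_left,
    key E₁ _ (fun t => by simp) hf.tendsto_right⟩
  · exact hg.smul hf.diffContOnCl
  · obtain ⟨C, hC⟩ := hf.bounded
    refine ⟨B * C, fun z hz => ?_⟩
    rw [map_smul, norm_smul]
    exact mul_le_mul (hB z hz) (hC z hz) (norm_nonneg _) ((norm_nonneg _).trans (hB z hz))

theorem continuous_toSpace_symm_toSpace [FiniteDimensional ℂ V] (E F : CNorm V) :
    Continuous fun x : E.Space => F.toSpace (E.toSpace.symm x) :=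
  (op LinearMap.id E F).continuous

theorem Admissible.continuous_left {E₀ E₁ : CNorm V} {f : ℂ → V} (hf : Admissible E₀ E₁ f) :
    Continuous fun t : ℝ => E₀.toSpace (f (t * Complex.I)) := by
  have h := hf.diffContOnCl.continuousOn
  rw [closure_strip] at h
  exact h.comp_continuous (f := fun t : ℝ => (t * Complex.I : ℂ)) (by fun_prop) fun t => by simp

theorem Admissible.continuous_right [FiniteDimensional ℂ V] {E₀ E₁ : CNorm V} {f : ℂ → V}
    (hf : Admissible E₀ E₁ f) :
    Continuous fun t : ℝ => E₁.toSpace (f (1 + t * Complex.I)) := by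
  have h := hf.diffContOnCl.continuousOn
  rw [closure_strip] at h
  exact (continuous_toSpace_symm_toSpace E₀ E₁).comp
    (h.comp_continuous (f := fun t : ℝ => (1 + t * Complex.I : ℂ)) (by fun_prop) fun t => by simp)

end CNorm

/-- A regularized logarithm of a function vanishing at infinity. -/
theorem tendsto_log_regularized {X : Type*} [NormedAddCommGroup X] {h : ℝ → X} {κ δ : ℝ}
    (hκ : 0 < κ) (hδ : 0 < δ) (hlim : Tendsto h (cocompact ℝ) (𝓝 0)) :
    Tendsto (fun t => κ * Real.log (‖h t‖ ^ (1 / κ) + δ ^ (1 / κ))) (cocompact ℝ)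
      (𝓝 (Real.log δ)) := by
  have hκ' : 0 < 1 / κ := one_div_pos.2 hκ
  have h1 : Tendsto (fun t => ‖h t‖ ^ (1 / κ) + δ ^ (1 / κ)) (cocompact ℝ)
      (𝓝 (0 + δ ^ (1 / κ))) := by
    have := (hlim.norm.rpow_const (p := 1 / κ) (Or.inr hκ'.le)).add_const (δ ^ (1 / κ))
    rwa [norm_zero, Real.zero_rpow hκ'.ne'] at this
  rw [zero_add] at h1
  have h2 := (h1.log (Real.rpow_pos_of_pos hδ _).ne').const_mul κ
  rwa [Real.log_rpow hδ, ← mul_assoc, mul_one_div_cancel hκ.ne', one_mul] at h2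

theorem continuous_log_regularized {X : Type*} [NormedAddCommGroup X] {h : ℝ → X} {κ δ : ℝ}
    (hκ : 0 < κ) (hδ : 0 < δ) (hc : Continuous h) :
    Continuous fun t => κ * Real.log (‖h t‖ ^ (1 / κ) + δ ^ (1 / κ)) := by
  refine continuous_const.mul (Continuous.log ?_ fun t => ?_)
  · exact (hc.norm.rpow_const fun t => Or.inr (one_div_pos.2 hκ).le).add continuous_const
  · exact (add_pos_of_nonneg_of_pos (Real.rpow_nonneg (norm_nonneg _) _)
      (Real.rpow_pos_of_pos hδ _)).ne'

/-- The regularized logarithm lies above log x, which makes exp(-G_j)h_j almost a contraction on the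
boundary; `lp_sum_regularized_le` shows that the excess is harmless in the ℓ_q-sum. -/
theorem le_exp_log_regularized {x κ δ : ℝ} (hx : 0 ≤ x) (hκ : 0 < κ) (hδ : 0 < δ) :
    x ≤ Real.exp (κ * Real.log (x ^ (1 / κ) + δ ^ (1 / κ))) := by
  have hpos : 0 < x ^ (1 / κ) + δ ^ (1 / κ) :=
    add_pos_of_nonneg_of_pos (Real.rpow_nonneg hx _) (Real.rpow_pos_of_pos hδ _)
  rw [mul_comm, ← Real.rpow_def_of_pos hpos]
  calc x = (x ^ (1 / κ)) ^ κ := by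
        rw [← Real.rpow_mul hx, one_div_mul_cancel hκ.ne', Real.rpow_one]
    _ ≤ _ := Real.rpow_le_rpow (Real.rpow_nonneg hx _)
        (le_add_of_nonneg_right (Real.rpow_nonneg hδ.le _)) hκ.le

/-- An error δ in y_j costs the factor exp(δ/κ) in each summand, hence exp(δ) after the power κ. As
δ^{1/κ} ≤ δ, the n regularizing summands add at most nδ, which vanishes with δ since n is fixed. -/
theorem lp_sum_regularized_le {n : ℕ} {x : Fin n → ℝ} {y : Fin n → ℝ} {κ δ : ℝ}
    (hx : ∀ j, 0 ≤ x j) (hκ : κ ∈ Set.Ioc (0 : ℝ) 1) (hδ : δ ∈ Set.Ioc (0 : ℝ) 1)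
    (hsum : ∑ j, x j ^ (1 / κ) ≤ 1)
    (hy : ∀ j, |y j - κ * Real.log (x j ^ (1 / κ) + δ ^ (1 / κ))| ≤ δ) :
    (∑ j, Real.exp (y j) ^ (1 / κ)) ^ κ ≤ Real.exp δ * (1 + n * δ) := by
  have hκ1 : 1 ≤ 1 / κ := (one_le_div hκ.1).2 hκ.2
  have h1 : ∀ j, Real.exp (y j) ^ (1 / κ) ≤ Real.exp (δ / κ) * (x j ^ (1 / κ) + δ) := by
    intro j
    have hpos : 0 < x j ^ (1 / κ) + δ ^ (1 / κ) :=
      add_pos_of_nonneg_of_pos (Real.rpow_nonneg (hx j) _) (Real.rpow_pos_of_pos hδ.1 _)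
    have h2 : y j * (1 / κ) ≤ δ / κ + Real.log (x j ^ (1 / κ) + δ ^ (1 / κ)) := by
      have := (abs_le.1 (hy j)).2
      rw [mul_one_div, div_add' _ _ _ hκ.1.ne']
      exact div_le_div_of_nonneg_right (by linarith) hκ.1.le
    calc Real.exp (y j) ^ (1 / κ) = Real.exp (y j * (1 / κ)) := by rw [Real.exp_mul]
      _ ≤ Real.exp (δ / κ + Real.log (x j ^ (1 / κ) + δ ^ (1 / κ))) := Real.exp_le_exp.2 h2
      _ = Real.exp (δ / κ) * (x j ^ (1 / κ) + δ ^ (1 / κ)) := by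
        rw [Real.exp_add, Real.exp_log hpos]
      _ ≤ _ := by
        gcongr
        calc δ ^ (1 / κ) ≤ δ ^ (1 : ℝ) := Real.rpow_le_rpow_of_exponent_ge hδ.1 hδ.2 hκ1
          _ = δ := Real.rpow_one δ
  have h3 : ∑ j, Real.exp (y j) ^ (1 / κ) ≤ Real.exp (δ / κ) * (1 + n * δ) := by
    refine (Finset.sum_le_sum fun j _ => h1 j).trans ?_
    rw [← Finset.mul_sum, Finset.sum_add_distrib]
    gcongr
    simp
  have hn : (1 : ℝ) ≤ 1 + n * δ := le_add_of_nonneg_right (mul_nonneg (Nat.cast_nonneg n) hδ.1.le)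
  calc (∑ j, Real.exp (y j) ^ (1 / κ)) ^ κ ≤ (Real.exp (δ / κ) * (1 + n * δ)) ^ κ :=
        Real.rpow_le_rpow (Finset.sum_nonneg fun j _ => by positivity) h3 hκ.1.le
    _ = Real.exp δ * (1 + n * δ) ^ κ := by
        rw [Real.mul_rpow (Real.exp_pos _).le (by linarith), ← Real.exp_mul,
          div_mul_cancel₀ _ hκ.1.ne']
    _ ≤ Real.exp δ * (1 + n * δ) ^ (1 : ℝ) := by
        gcongr
        exact hκ.2
    _ = _ := by rw [Real.rpow_one]

namespace CNorm

variable {W : Type v} [AddCommGroup W] [Module ℂ W]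

/-- The norm-one embedding `[ℓ_{q₀}(F₀), ℓ_{q₁}(F₁)]_θ → ℓ_q(F_θ)`, where `q = 1 / κ`. -/
theorem interp_lp_le [FiniteDimensional ℂ W] {F₀ F₁ : CNorm W} {n : ℕ} {h : Fin n → ℂ → W}
    (hh : ∀ j, Admissible F₀ F₁ (h j)) {κ₀ κ₁ κ : ℝ} {θ : unitInterval}
    (hκ₀ : κ₀ ∈ Set.Ioc (0 : ℝ) 1) (hκ₁ : κ₁ ∈ Set.Ioc (0 : ℝ) 1)
    (hκ : κ = (1 - (θ : ℝ)) * κ₀ + (θ : ℝ) * κ₁) (hκ' : κ ∈ Set.Ioc (0 : ℝ) 1)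
    (h₀ : ∀ t : ℝ, ∑ j, F₀.toSeminorm (h j (t * Complex.I)) ^ (1 / κ₀) ≤ 1)
    (h₁ : ∀ t : ℝ, ∑ j, F₁.toSeminorm (h j (1 + t * Complex.I)) ^ (1 / κ₁) ≤ 1) :
    (∑ j, interpFun θ F₀ F₁ (h j ((θ : ℝ) : ℂ)) ^ (1 / κ)) ^ κ ≤ 1 := by
  have key : ∀ δ ∈ Set.Ioc (0 : ℝ) 1,
      (∑ j, interpFun θ F₀ F₁ (h j ((θ : ℝ) : ℂ)) ^ (1 / κ)) ^ κ ≤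
        Real.exp δ * (Real.exp δ * (1 + n * δ)) := by
    intro δ hδ
    -- The summand δ^{1/κ} keeps the logarithm finite at zeros of h_j. Its exponent is chosen so
    -- that the limit at infinity is log δ for κ₀ and κ₁ alike, as the approximation requires a
    -- common limit on both lines.
    choose G hGd hGb hG₀ hG₁ using fun j => exists_analytic_re_close
      (continuous_log_regularized hκ₀.1 hδ.1 (hh j).continuous_left)
      (continuous_log_regularized hκ₁.1 hδ.1 (hh j).continuous_right)
      (tendsto_log_regularized hκ₀.1 hδ.1 (hh j).tendsto_left)
      (tendsto_log_regularized hκ₁.1 hδ.1 (hh j).tendsto_right) hδ.1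
    have hexp : ∀ (c : ℂ) (j : Fin n), DiffContOnCl ℂ (fun z => Complex.exp (c * G j z))
        (Complex.re ⁻¹' Set.Ioo (0 : ℝ) 1) := fun c j =>
      (by fun_prop : Differentiable ℂ fun w : ℂ => Complex.exp (c * w)).comp_diffContOnCl (hGd j)
    have hexpb : ∀ (c : ℂ) (j : Fin n), ∃ B : ℝ, ∀ z : ℂ, z.re ∈ Set.Icc (0 : ℝ) 1 →
        ‖Complex.exp (c * G j z)‖ ≤ B := fun c j => by
      obtain ⟨C, hC⟩ := hGb j
      refine ⟨Real.exp (‖c‖ * C), fun z hz => ?_⟩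
      rw [Complex.norm_exp]
      refine Real.exp_le_exp.2 ((Complex.re_le_norm _).trans ?_)
      rw [norm_mul]
      exact mul_le_mul_of_nonneg_left (hC z hz) (norm_nonneg c)
    have hbd : ∀ {x y κ : ℝ}, 0 ≤ x → 0 < κ →
        |y - κ * Real.log (x ^ (1 / κ) + δ ^ (1 / κ))| ≤ δ → Real.exp (-y) * x ≤ Real.exp δ := by
      intro x y κ hx hκ hy
      have h1 := le_exp_log_regularized hx hκ hδ.1
      calc Real.exp (-y) * x ≤ Real.exp (-y) *
            Real.exp (κ * Real.log (x ^ (1 / κ) + δ ^ (1 / κ))) := by gcongr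
        _ ≤ Real.exp δ := by
          rw [← Real.exp_add]
          exact Real.exp_le_exp.2 (by linarith [(abs_le.1 hy).1])
    have hf : ∀ j, Admissible F₀ F₁ fun z => Complex.exp (-1 * G j z) • h j z := fun j =>
      (hh j).mul_fun (hexp (-1) j) (hexpb (-1) j)
    have hfn : ∀ j, stripNorm F₀ F₁ (fun z => Complex.exp (-1 * G j z) • h j z) ≤ Real.exp δ := by
      intro j
      refine max_le (ciSup_le fun t => ?_) (ciSup_le fun t => ?_)
      · rw [map_smul_eq_mul, Complex.norm_exp, neg_one_mul, Complex.neg_re]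
        exact hbd (apply_nonneg _ _) hκ₀.1 (hG₀ j t)
      · rw [map_smul_eq_mul, Complex.norm_exp, neg_one_mul, Complex.neg_re]
        exact hbd (apply_nonneg _ _) hκ₁.1 (hG₁ j t)
    have hint : ∀ j, interpFun θ F₀ F₁ (h j ((θ : ℝ) : ℂ)) ≤
        Real.exp δ * ‖Complex.exp (1 * G j ((θ : ℝ) : ℂ))‖ := by
      intro j
      have h1 := (interpFun_le (θ := θ) (hf j)).trans (hfn j)
      -- At the point θ, exp(G_j) is a mere scalar and leaves the norm of F_θ by homogeneity; the
      -- other factor is the value of a Calderón function of norm at most exp(δ).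
      have h2 : h j ((θ : ℝ) : ℂ) = Complex.exp (1 * G j ((θ : ℝ) : ℂ)) •
          (Complex.exp (-1 * G j ((θ : ℝ) : ℂ)) • h j ((θ : ℝ) : ℂ)) := by
        rw [smul_smul, ← Complex.exp_add]
        simp
      rw [h2, mul_comm (Real.exp δ)]
      exact (interpFun_smul_le θ F₀ F₁ _ _).trans
        (mul_le_mul_of_nonneg_left h1 (norm_nonneg _))
    have h3 := three_lines_lp (hexp 1) (hexpb 1) hκ₀ hκ₁ θ.2 hκ hκ'
      (K := Real.exp δ * (1 + n * δ))
      (fun t => by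
        simp_rw [Complex.norm_exp, one_mul]
        exact lp_sum_regularized_le (fun j => apply_nonneg _ _) hκ₀ hδ (h₀ t)
          fun j => hG₀ j t)
      (fun t => by
        simp_rw [Complex.norm_exp, one_mul]
        exact lp_sum_regularized_le (fun j => apply_nonneg _ _) hκ₁ hδ (h₁ t)
          fun j => hG₁ j t)
      (fun j => Complex.exp_ne_zero _)
    have hκ0 : 0 ≤ 1 / κ := (one_div_pos.2 hκ'.1).le
    calc (∑ j, interpFun θ F₀ F₁ (h j ((θ : ℝ) : ℂ)) ^ (1 / κ)) ^ κ
        ≤ (∑ j, (Real.exp δ * ‖Complex.exp (1 * G j ((θ : ℝ) : ℂ))‖) ^ (1 / κ)) ^ κ := by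
          refine Real.rpow_le_rpow (Finset.sum_nonneg fun j _ =>
            Real.rpow_nonneg (interpFun_nonneg _ _ _ _) _) ?_ hκ'.1.le
          exact Finset.sum_le_sum fun j _ =>
            Real.rpow_le_rpow (interpFun_nonneg _ _ _ _) (hint j) hκ0
      _ = Real.exp δ * (∑ j, ‖Complex.exp (1 * G j ((θ : ℝ) : ℂ))‖ ^ (1 / κ)) ^ κ := by
          simp_rw [Real.mul_rpow (Real.exp_pos δ).le (norm_nonneg _)]
          rw [← Finset.mul_sum, Real.mul_rpow (by positivity)
            (Finset.sum_nonneg fun j _ => by positivity), ← Real.rpow_mul (Real.exp_pos δ).le,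
            one_div_mul_cancel hκ'.1.ne', Real.rpow_one]
      _ ≤ _ := mul_le_mul_of_nonneg_left h3 (Real.exp_pos δ).le
  have hlim : Tendsto (fun δ : ℝ => Real.exp δ * (Real.exp δ * (1 + n * δ))) (𝓝[>] 0) (𝓝 1) := by
    have hc : Continuous fun δ : ℝ => Real.exp δ * (Real.exp δ * (1 + n * δ)) := by fun_prop
    have := hc.tendsto 0
    simp only [Real.exp_zero, mul_zero, add_zero, mul_one] at this
    exact this.mono_left nhdsWithin_le_nhds
  refine ge_of_tendsto hlim ?_
  filter_upwards [Ioc_mem_nhdsGT (zero_lt_one (α := ℝ))] with δ hδ using key δ hδ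

end CNorm

/-! ### Finite `ℓ_s`-norms and their duality -/

/-- The reciprocal `1 - 1/s` of the exponent conjugate to `s`. -/
def conjInv (s : ℝ≥0∞) : ℝ := 1 - s⁻¹.toReal

theorem conjInv_top : conjInv ∞ = 1 := by simp [conjInv]

theorem conjInv_eq (s : ℝ≥0∞) : conjInv s = 1 - 1 / s.toReal := by
  rw [conjInv, ENNReal.toReal_inv, one_div]

theorem two_le_toReal {s : ℝ≥0∞} (hs : 2 ≤ s) (hs' : s ≠ ∞) : 2 ≤ s.toReal := by
  simpa using ENNReal.toReal_mono hs' hs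

theorem conjInv_mem {s : ℝ≥0∞} (hs : 2 ≤ s) : conjInv s ∈ Set.Ioc (0 : ℝ) 1 := by
  rcases eq_or_ne s ∞ with rfl | hs'
  · simp [conjInv_top]
  · have h2 := two_le_toReal hs hs'
    rw [conjInv_eq]
    have h3 : 1 / s.toReal ≤ 1 / 2 := one_div_le_one_div_of_le two_pos h2
    have h4 : 0 < 1 / s.toReal := by positivity
    exact ⟨by linarith, by linarith⟩

theorem one_le_of_two_le {s : ℝ≥0∞} (hs : 2 ≤ s) : 1 ≤ s := le_trans (by norm_num) hs

theorem PiLp.norm_le_norm_of_forall {ι : Type*} [Fintype ι] {X Y : Type*}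
    [NormedAddCommGroup X] [NormedAddCommGroup Y] {s : ℝ≥0∞} (hs : 1 ≤ s) {a : ι → X} {b : ι → Y}
    (h : ∀ i, ‖a i‖ ≤ ‖b i‖) :
    ‖(WithLp.toLp s a : PiLp s fun _ : ι => X)‖ ≤ ‖(WithLp.toLp s b : PiLp s fun _ : ι => Y)‖ := by
  rcases eq_or_ne s ∞ with rfl | hs'
  · rw [PiLp.norm_eq_ciSup, PiLp.norm_eq_ciSup]
    exact Finite.ciSup_mono fun i => h i
  · have hr : 0 < s.toReal := ENNReal.toReal_pos (zero_lt_one.trans_le hs).ne' hs'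
    rw [PiLp.norm_eq_sum hr, PiLp.norm_eq_sum hr]
    have h1 : 0 ≤ 1 / s.toReal := by positivity
    refine Real.rpow_le_rpow (Finset.sum_nonneg fun i _ => by positivity) ?_ h1
    exact Finset.sum_le_sum fun i _ => Real.rpow_le_rpow (norm_nonneg _) (h i) hr.le

/-- Hölder's inequality for finite sequences. -/
theorem sum_mul_norm_le {ι : Type*} [Fintype ι] {X : Type*} [NormedAddCommGroup X] {s : ℝ≥0∞}
    (hs : 2 ≤ s) {f : ι → ℝ} (hf : ∀ i, 0 ≤ f i) (b : ι → X) :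
    ∑ i, f i * ‖b i‖ ≤ (∑ i, f i ^ (1 / conjInv s)) ^ conjInv s *
      ‖(WithLp.toLp s b : PiLp s fun _ : ι => X)‖ := by
  have : Fact (1 ≤ s) := ⟨one_le_of_two_le hs⟩
  rcases eq_or_ne s ∞ with rfl | hs'
  · simp only [conjInv_top, div_one, Real.rpow_one]
    rw [Finset.sum_mul]
    refine Finset.sum_le_sum fun i _ => mul_le_mul_of_nonneg_left ?_ (hf i)
    exact PiLp.norm_apply_le (WithLp.toLp ∞ b : PiLp ∞ fun _ : ι => X) i
  · have h2 := two_le_toReal hs hs'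
    have hr : 0 < s.toReal := by linarith
    have hκ := conjInv_mem hs
    have hc : (1 / conjInv s).HolderConjugate s.toReal := by
      rw [Real.holderConjugate_iff]
      refine ⟨(one_lt_div hκ.1).2 ?_, ?_⟩
      · rw [conjInv_eq]
        linarith [one_div_pos.2 hr]
      · rw [one_div, inv_inv, conjInv_eq, one_div]
        ring
    have h := Real.inner_le_Lp_mul_Lq_of_nonneg Finset.univ hc (fun i _ => hf i)
      (fun i _ => norm_nonneg (b i))
    rw [one_div_one_div] at h
    rwa [PiLp.norm_eq_sum hr]

/-- Hölder's inequality is sharp. -/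
theorem exists_extremal {ι : Type*} [Fintype ι] {s : ℝ≥0∞} (hs : 2 ≤ s) (b : ι → ℂ) :
    ∃ f : ι → ℂ, (∑ i, ‖f i‖ ^ (1 / conjInv s)) ^ conjInv s ≤ 1 ∧
      ∑ i, f i * b i = ‖(WithLp.toLp s b : PiLp s fun _ : ι => ℂ)‖ := by
  classical
  have hκ := conjInv_mem hs
  have hκ1 : 0 < 1 / conjInv s := one_div_pos.2 hκ.1
  have hphase : ∀ w : ℂ, (starRingEnd ℂ) w / ‖w‖ * w = ‖w‖ := fun w => by
    rcases eq_or_ne w 0 with rfl | hw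
    · simp
    · have := norm_ne_zero_iff.2 hw
      rw [div_mul_eq_mul_div, mul_comm, Complex.mul_conj, Complex.normSq_eq_norm_sq]
      push_cast
      field_simp
  have hphase' : ∀ w : ℂ, ‖(starRingEnd ℂ) w / ‖w‖‖ ≤ 1 := fun w => by
    rw [norm_div, RCLike.norm_conj, Complex.norm_real, norm_norm]
    exact div_self_le_one _
  rcases eq_or_ne s ∞ with rfl | hs'
  · rw [PiLp.norm_eq_ciSup]
    simp only [conjInv_top, div_one, Real.rpow_one]
    rcases isEmpty_or_nonempty ι with he | he
    · exact ⟨fun _ => 0, by simp, by simp⟩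
    · obtain ⟨i₀, hi₀⟩ := exists_eq_ciSup_of_finite (f := fun i => ‖b i‖)
      refine ⟨Pi.single i₀ ((starRingEnd ℂ) (b i₀) / ‖b i₀‖), ?_, ?_⟩
      · rw [Finset.sum_eq_single i₀ (fun i _ hi => by simp [hi]) (by simp)]
        simpa using hphase' (b i₀)
      · rw [Finset.sum_eq_single i₀ (fun i _ hi => by simp [hi]) (by simp)]
        rw [Pi.single_eq_same, hphase, ← hi₀]
  · have h2 := two_le_toReal hs hs'
    have hr : 0 < s.toReal := by linarith
    rw [PiLp.norm_eq_sum hr]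
    set A := ∑ i, ‖b i‖ ^ s.toReal with hA
    have hA0 : 0 ≤ A := Finset.sum_nonneg fun i _ => by positivity
    rcases hA0.eq_or_lt with h0 | hApos
    · refine ⟨fun _ => 0, by simp only [norm_zero, Real.zero_rpow hκ1.ne', Finset.sum_const_zero,
        Real.zero_rpow hκ.1.ne', zero_le_one], ?_⟩
      simp only [← h0]
      rw [Real.zero_rpow (one_div_pos.2 hr).ne']
      simp
    · refine ⟨fun i => (starRingEnd ℂ) (b i) / ‖b i‖ *
        (((‖b i‖ ^ s.toReal / A) ^ conjInv s : ℝ) : ℂ), ?_, ?_⟩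
      · refine Real.rpow_le_one (Finset.sum_nonneg fun i _ => by positivity) ?_ hκ.1.le
        calc ∑ i, ‖(starRingEnd ℂ) (b i) / ‖b i‖ *
              (((‖b i‖ ^ s.toReal / A) ^ conjInv s : ℝ) : ℂ)‖ ^ (1 / conjInv s)
            ≤ ∑ i, ‖b i‖ ^ s.toReal / A := by
              refine Finset.sum_le_sum fun i _ => ?_
              have hβ : 0 ≤ ‖b i‖ ^ s.toReal / A := by positivity
              rw [norm_mul, Complex.norm_real, Real.norm_of_nonneg (Real.rpow_nonneg hβ _)]
              calc _ ≤ (1 * (‖b i‖ ^ s.toReal / A) ^ conjInv s) ^ (1 / conjInv s) := by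
                    refine Real.rpow_le_rpow (by positivity) ?_ hκ1.le
                    exact mul_le_mul_of_nonneg_right (hphase' _) (Real.rpow_nonneg hβ _)
                _ = _ := by
                    rw [one_mul, ← Real.rpow_mul hβ, mul_one_div_cancel hκ.1.ne', Real.rpow_one]
          _ = 1 := by rw [← Finset.sum_div, ← hA, div_self hApos.ne']
      · have h := sum_mul_extremal_weight Finset.univ (fun i => norm_nonneg (b i))
          (κ := 1 / s.toReal) ⟨one_div_pos.2 hr, by
            rw [div_le_one hr]; linarith⟩ (by rwa [one_div_one_div])
        rw [one_div_one_div, ← conjInv_eq] at h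
        rw [← h]
        push_cast
        refine Finset.sum_congr rfl fun i _ => ?_
        rw [mul_right_comm, hphase]

/-- Here 1 - `conjInv s` = 1/s, so the s-th powers of the weights sum to at most 1. For s = ∞ all
weights are 1, also where β_i = 0, since `0 ^ 0 = 1`. -/
theorem norm_rpow_weight_le_one {ι : Type*} [Fintype ι] {s : ℝ≥0∞} (hs : 2 ≤ s) {β : ι → ℝ}
    (hβ : ∀ i, 0 ≤ β i) (hsum : ∑ i, β i ≤ 1) :
    ‖(WithLp.toLp s (fun i => β i ^ (1 - conjInv s)) : PiLp s fun _ : ι => ℝ)‖ ≤ 1 := by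
  rcases eq_or_ne s ∞ with rfl | hs'
  · rw [PiLp.norm_eq_ciSup]
    simp only [conjInv_top, sub_self, Real.rpow_zero, norm_one]
    rcases isEmpty_or_nonempty ι with he | he
    · simp
    · exact ciSup_le fun i => le_rfl
  · have h2 := two_le_toReal hs hs'
    have hr : 0 < s.toReal := by linarith
    rw [PiLp.norm_eq_sum hr]
    refine Real.rpow_le_one (Finset.sum_nonneg fun i _ => by positivity) ?_
      (one_div_pos.2 hr).le
    refine le_trans (le_of_eq (Finset.sum_congr rfl fun i _ => ?_)) hsum
    rw [conjInv_eq, Real.norm_of_nonneg (Real.rpow_nonneg (hβ i) _), ← Real.rpow_mul (hβ i),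
      sub_sub_cancel, one_div_mul_cancel hr.ne', Real.rpow_one]

/-! ### Weak norms and summing operators -/

theorem map_eq_sum_single {V : Type*} [AddCommGroup V] [Module ℂ V] {m : ℕ}
    (X : EuclideanSpace ℂ (Fin m) →ₗ[ℂ] V) (a : EuclideanSpace ℂ (Fin m)) :
    X a = ∑ k, a k • X (EuclideanSpace.single k 1) := by
  conv_lhs => rw [← (EuclideanSpace.basisFun (Fin m) ℂ).sum_repr a]
  simp

section Summing

variable {E : Type u} {F : Type v} [NormedAddCommGroup E] [NormedSpace ℂ E]
  [NormedAddCommGroup F] [NormedSpace ℂ F]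

theorem le_weakLpNorm (p : ℝ≥0∞) {n : ℕ} (x : Fin n → E) {φ : StrongDual ℂ E} (hφ : ‖φ‖ ≤ 1) :
    ENNReal.ofReal ‖(WithLp.toLp p (fun i => φ (x i)) : PiLp p (fun _ : Fin n => ℂ))‖ ≤
      weakLpNorm p x :=
  le_iSup₂_of_le φ hφ le_rfl

theorem weakLpNorm_le {p : ℝ≥0∞} {n : ℕ} {x : Fin n → E} {C : ℝ}
    (h : ∀ φ : StrongDual ℂ E, ‖φ‖ ≤ 1 →
      ‖(WithLp.toLp p (fun i => φ (x i)) : PiLp p (fun _ : Fin n => ℂ))‖ ≤ C) :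
    weakLpNorm p x ≤ ENNReal.ofReal C :=
  iSup₂_le fun φ hφ => ENNReal.ofReal_le_ofReal (h φ hφ)

theorem weakLpNorm_ne_top {p : ℝ≥0∞} (hp : 1 ≤ p) {n : ℕ} (x : Fin n → E) :
    weakLpNorm p x ≠ ∞ := by
  refine ne_top_of_le_ne_top ENNReal.ofReal_ne_top (weakLpNorm_le (x := x) (p := p)
    (C := ‖(WithLp.toLp p x : PiLp p fun _ : Fin n => E)‖) fun φ hφ => ?_)
  refine PiLp.norm_le_norm_of_forall hp fun i => (φ.le_opNorm _).trans ?_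
  exact mul_le_of_le_one_left (norm_nonneg _) hφ

/-- The infimum defining the summing norm is itself admissible: pass to the limit in the inequality,
which is possible because the weak norm is finite. -/
theorem norm_le_of_summingNorm_le {r p : ℝ≥0∞} (hp : 1 ≤ p) {T : E →L[ℂ] F} {C : ℝ≥0}
    (h : summingNorm r p T ≤ C) {n : ℕ} (x : Fin n → E) :
    ENNReal.ofReal ‖(WithLp.toLp r (fun i => T (x i)) : PiLp r (fun _ : Fin n => F))‖ ≤
      C * weakLpNorm p x := by
  have hw := weakLpNorm_ne_top hp x
  have key : ∀ ε : ℝ≥0, 0 < ε →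
      ENNReal.ofReal ‖(WithLp.toLp r (fun i => T (x i)) : PiLp r (fun _ : Fin n => F))‖ ≤
        ((C : ℝ≥0∞) + ε) * weakLpNorm p x := by
    intro ε hε
    have h1 : summingNorm r p T < (C : ℝ≥0∞) + ε :=
      h.trans_lt (ENNReal.lt_add_right ENNReal.coe_ne_top (by exact_mod_cast hε.ne'))
    simp only [summingNorm, iInf_lt_iff] at h1
    obtain ⟨ρ, hρ, hρC⟩ := h1
    exact (hρ n x).trans (mul_le_mul_left hρC.le _)
  have hlim : Tendsto (fun ε : ℝ≥0 => ((C : ℝ≥0∞) + ε) * weakLpNorm p x) (𝓝[>] 0)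
      (𝓝 (((C : ℝ≥0∞) + (0 : ℝ≥0)) * weakLpNorm p x)) := by
    have h1 : Tendsto (fun ε : ℝ≥0 => (ε : ℝ≥0∞)) (𝓝[>] 0) (𝓝 ((0 : ℝ≥0) : ℝ≥0∞)) :=
      (ENNReal.continuous_coe.tendsto 0).mono_left nhdsWithin_le_nhds
    exact ENNReal.Tendsto.mul_const (tendsto_const_nhds.add h1) (Or.inr hw)
  rw [ENNReal.coe_zero, add_zero] at hlim
  refine ge_of_tendsto hlim ?_
  filter_upwards [self_mem_nhdsWithin] with ε hε using key ε hε

theorem summingNorm_le {r p : ℝ≥0∞} {T : E →L[ℂ] F} {C : ℝ≥0}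
    (h : ∀ (n : ℕ) (x : Fin n → E),
      ENNReal.ofReal ‖(WithLp.toLp r (fun i => T (x i)) : PiLp r (fun _ : Fin n => F))‖ ≤
        C * weakLpNorm p x) : summingNorm r p T ≤ C :=
  iInf₂_le C h

theorem norm_toLp_apply_single {m : ℕ} (ψ : StrongDual ℂ (EuclideanSpace ℂ (Fin m))) :
    ‖(WithLp.toLp 2 (fun k => ψ (EuclideanSpace.single k 1)) : PiLp 2 (fun _ : Fin m => ℂ))‖ =
      ‖ψ‖ := by
  set y := (InnerProductSpace.toDual ℂ (EuclideanSpace ℂ (Fin m))).symm ψ with hy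
  have h1 : ‖y‖ = ‖ψ‖ := LinearIsometryEquiv.norm_map _ _
  have h2 : ∀ k, ψ (EuclideanSpace.single k 1) = (starRingEnd ℂ) (y k) := fun k => by
    have : ψ = InnerProductSpace.toDual ℂ (EuclideanSpace ℂ (Fin m)) y := by simp [hy]
    rw [this, InnerProductSpace.toDual_apply_apply, EuclideanSpace.inner_single_right, one_mul]
  rw [← h1, EuclideanSpace.norm_eq, EuclideanSpace.norm_eq]
  simp [h2]

/-- The weak `ℓ_2`-norm of a finite family is the norm of the induced operator on `ℓ_2^m`. -/
theorem weakLpNorm_two {m : ℕ} (X : EuclideanSpace ℂ (Fin m) →L[ℂ] E) :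
    weakLpNorm 2 (fun k => X (EuclideanSpace.single k 1)) = ENNReal.ofReal ‖X‖ := by
  apply le_antisymm
  · refine weakLpNorm_le fun φ hφ => ?_
    have h := norm_toLp_apply_single (φ.comp X)
    refine (le_of_eq h).trans ((ContinuousLinearMap.opNorm_comp_le φ X).trans ?_)
    exact mul_le_of_le_one_left (norm_nonneg _) hφ
  · have hw := weakLpNorm_ne_top (one_le_of_two_le le_rfl)
      (fun k => X (EuclideanSpace.single k 1))
    rw [← ENNReal.ofReal_toReal hw]
    refine ENNReal.ofReal_le_ofReal (X.opNorm_le_bound ENNReal.toReal_nonneg fun v => ?_)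
    obtain ⟨φ, hφ, hφv⟩ := exists_dual_vector'' ℂ (X v)
    have h1 := le_weakLpNorm 2 (fun k => X (EuclideanSpace.single k 1)) hφ
    rw [ENNReal.ofReal_le_iff_le_toReal hw] at h1
    have h2 := norm_toLp_apply_single (φ.comp X)
    have h3 := (φ.comp X).le_opNorm v
    rw [← h2, ContinuousLinearMap.comp_apply, hφv] at h3
    simp only [Complex.coe_algebraMap, Complex.norm_real, norm_norm] at h3
    exact h3.trans (mul_le_mul_of_nonneg_right h1 (norm_nonneg _))

/-- The operator `ℓ_2^m → E` sending the unit vectors to a given family. -/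
def familyOp {m : ℕ} (x : Fin m → E) : EuclideanSpace ℂ (Fin m) →L[ℂ] E :=
  LinearMap.toContinuousLinearMap ((EuclideanSpace.basisFun (Fin m) ℂ).toBasis.constr ℂ x)

theorem familyOp_single {m : ℕ} (x : Fin m → E) (k : Fin m) :
    familyOp x (EuclideanSpace.single k 1) = x k := by
  simp [familyOp]

theorem summingNorm_two_le {T : E →L[ℂ] F} {C : ℝ} (hC : 0 ≤ C)
    (h : ∀ (m : ℕ) (X : EuclideanSpace ℂ (Fin m) →L[ℂ] E),
      ‖(WithLp.toLp 2 (fun k => T (X (EuclideanSpace.single k 1))) :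
        PiLp 2 (fun _ : Fin m => F))‖ ≤ C * ‖X‖) :
    summingNorm 2 2 T ≤ ENNReal.ofReal C := by
  refine summingNorm_le fun m x => ?_
  have h1 := h m (familyOp x)
  have h2 := weakLpNorm_two (familyOp x)
  simp only [familyOp_single] at h1 h2
  rw [h2]
  exact (ENNReal.ofReal_le_ofReal h1).trans (le_of_eq (ENNReal.ofReal_mul hC))

theorem norm_le_of_summingNorm_two_le {T : E →L[ℂ] F} {C : ℝ} (hC : 0 ≤ C)
    (h : summingNorm 2 2 T ≤ ENNReal.ofReal C) {m : ℕ} (X : EuclideanSpace ℂ (Fin m) →L[ℂ] E) :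
    ‖(WithLp.toLp 2 (fun k => T (X (EuclideanSpace.single k 1))) :
        PiLp 2 (fun _ : Fin m => F))‖ ≤ C * ‖X‖ := by
  have h1 := norm_le_of_summingNorm_le (one_le_of_two_le le_rfl) h
    (fun k => X (EuclideanSpace.single k 1))
  rw [weakLpNorm_two] at h1
  have h2 : ((C.toNNReal : ℝ≥0) : ℝ≥0∞) * ENNReal.ofReal ‖X‖ = ENNReal.ofReal (C * ‖X‖) :=
    (ENNReal.ofReal_mul hC).symm
  rw [h2, ENNReal.ofReal_le_ofReal_iff (by positivity)] at h1
  exact h1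

/-- The summing norm dominates the operator norm, as families with a single member show. -/
theorem norm_apply_le_of_summingNorm_le_one {s : ℝ≥0∞} (hs : 1 ≤ s) {S : E →L[ℂ] F}
    (hS : summingNorm s s S ≤ 1) (y : E) : ‖S y‖ ≤ ‖y‖ := by
  have : Fact (1 ≤ s) := ⟨hs⟩
  have hone : ∀ {X : Type _} [NormedAddCommGroup X] (w : X),
      ‖w‖ ≤ ‖(WithLp.toLp s (fun _ => w) : PiLp s (fun _ : Fin 1 => X))‖ := fun {X} _ w =>
    PiLp.norm_apply_le (WithLp.toLp s (fun _ => w) : PiLp s (fun _ : Fin 1 => X)) 0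
  have h1 := norm_le_of_summingNorm_le hs (C := 1) (by simpa using hS) (fun _ : Fin 1 => y)
  have h2 : weakLpNorm s (fun _ : Fin 1 => y) ≤ ENNReal.ofReal ‖y‖ := by
    refine weakLpNorm_le fun φ hφ => ?_
    have h3 : ‖(WithLp.toLp s (fun _ => φ y) : PiLp s (fun _ : Fin 1 => ℂ))‖ ≤ ‖φ y‖ := by
      rcases eq_or_ne s ∞ with rfl | hs'
      · rw [PiLp.norm_eq_ciSup]
        exact ciSup_le fun i => le_rfl
      · have hr : 0 < s.toReal := ENNReal.toReal_pos (zero_lt_one.trans_le hs).ne' hs'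
        rw [PiLp.norm_eq_sum hr]
        simp [Real.rpow_rpow_inv (norm_nonneg (φ y)) hr.ne']
    refine h3.trans ((φ.le_opNorm _).trans ?_)
    exact mul_le_of_le_one_left (norm_nonneg _) hφ
  rw [ENNReal.coe_one, one_mul] at h1
  have h4 := h1.trans h2
  rw [ENNReal.ofReal_le_ofReal_iff (norm_nonneg _)] at h4
  exact (hone (S y)).trans h4

end Summing

/-! ### Mixing operators -/

section Mixing

variable {E : Type u} {F : Type v} [NormedAddCommGroup E] [NormedSpace ℂ E]
  [NormedAddCommGroup F] [NormedSpace ℂ F]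

/-- The norm of `ℓ_2^m(ℓ_q^n)` with `q = 1 / κ`, on families of vectors of `ℂ^m`. -/
def mixedNorm (κ : ℝ) {m n : ℕ} (a : Fin n → EuclideanSpace ℂ (Fin m)) : ℝ :=
  ‖(WithLp.toLp 2 (fun k => (∑ j, ‖a j k‖ ^ (1 / κ)) ^ κ) : PiLp 2 fun _ : Fin m => ℝ)‖

/-- The bilinear map `(X, a) ↦ (T X a_j)_j` from `L(ℓ_2^m, E) × ℓ_2^m(ℓ_q^n)` to `ℓ_q^n(F)` has
norm at most `c`, where `q = 1 / κ`. -/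
def MixBound (κ : ℝ) (T : E →L[ℂ] F) (c : ℝ) : Prop :=
  ∀ (m n : ℕ) (X : EuclideanSpace ℂ (Fin m) →L[ℂ] E) (a : Fin n → EuclideanSpace ℂ (Fin m)),
    (∑ j, ‖T (X (a j))‖ ^ (1 / κ)) ^ κ ≤ c * ‖X‖ * mixedNorm κ a

theorem MixBound.mono {κ c c' : ℝ} {T : E →L[ℂ] F} (h : MixBound κ T c) (hc : c ≤ c') :
    MixBound κ T c' := fun m n X a =>
  (h m n X a).trans (mul_le_mul_of_nonneg_right
    (mul_le_mul_of_nonneg_right hc (norm_nonneg _)) (norm_nonneg _))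

theorem cauchy_schwarz_toLp {m : ℕ} {X Y : Type*} [NormedAddCommGroup X] [NormedAddCommGroup Y]
    (a : Fin m → X) (b : Fin m → Y) :
    ∑ k, ‖a k‖ * ‖b k‖ ≤ ‖(WithLp.toLp 2 a : PiLp 2 fun _ : Fin m => X)‖ *
      ‖(WithLp.toLp 2 b : PiLp 2 fun _ : Fin m => Y)‖ := by
  rw [PiLp.norm_eq_of_L2, PiLp.norm_eq_of_L2]
  exact Real.sum_mul_le_sqrt_mul_sqrt _ _ _

/-- The diagonal operator `y ↦ (λ_j φ_j(y))_j` into `ℓ_s^n`. -/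
def diagOp (s : ℝ≥0∞) [Fact (1 ≤ s)] {n : ℕ} (lam : Fin n → ℝ) (φ : Fin n → StrongDual ℂ F) :
    F →L[ℂ] PiLp s (fun _ : ULift.{v} (Fin n) => ℂ) :=
  (PiLp.continuousLinearEquiv s ℂ (fun _ : ULift.{v} (Fin n) => ℂ)).symm.toContinuousLinearMap.comp
    (ContinuousLinearMap.pi fun j => (lam j.down : ℂ) • φ j.down)

theorem diagOp_apply (s : ℝ≥0∞) [Fact (1 ≤ s)] {n : ℕ} (lam : Fin n → ℝ)
    (φ : Fin n → StrongDual ℂ F) (y : F) (j : ULift.{v} (Fin n)) :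
    diagOp s lam φ y j = lam j.down * φ j.down y := rfl

/-- For finite s, exchange the two sums: ∑_j |λ_j|^s ∑_i |φ_j(x_i)|^s, where each inner sum is
bounded by the s-th power of the weak norm. -/
theorem summingNorm_diagOp_le {s : ℝ≥0∞} [Fact (1 ≤ s)] {n : ℕ} {lam : Fin n → ℝ}
    {φ : Fin n → StrongDual ℂ F} (hφ : ∀ j, ‖φ j‖ ≤ 1)
    (hlam : ‖(WithLp.toLp s lam : PiLp s fun _ : Fin n => ℝ)‖ ≤ 1) :
    summingNorm s s (diagOp s lam φ) ≤ 1 := by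
  have hs : 1 ≤ s := Fact.out
  refine summingNorm_le (C := 1) fun N x => ?_
  rw [ENNReal.coe_one, one_mul]
  have hw := weakLpNorm_ne_top hs x
  rw [ENNReal.ofReal_le_iff_le_toReal hw]
  set w := (weakLpNorm s x).toReal
  have hw0 : 0 ≤ w := ENNReal.toReal_nonneg
  have hj : ∀ j, ‖(WithLp.toLp s (fun i => φ j (x i)) : PiLp s fun _ : Fin N => ℂ)‖ ≤ w :=
    fun j => (ENNReal.ofReal_le_iff_le_toReal hw).1 (le_weakLpNorm s x (hφ j))
  rcases eq_or_ne s ∞ with rfl | hs'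
  · rw [PiLp.norm_eq_ciSup]
    refine Real.iSup_le (fun i => ?_) hw0
    rw [PiLp.norm_eq_ciSup]
    refine Real.iSup_le (fun j => ?_) hw0
    rw [diagOp_apply, norm_mul, Complex.norm_real]
    have h1 := (PiLp.norm_apply_le (WithLp.toLp ∞ lam : PiLp ∞ fun _ : Fin n => ℝ) j.down).trans
      hlam
    have h2 := (PiLp.norm_apply_le (WithLp.toLp ∞ (fun i => φ j.down (x i)) :
      PiLp ∞ fun _ : Fin N => ℂ) i).trans (hj j.down)
    exact (mul_le_of_le_one_left (norm_nonneg _) h1).trans h2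
  · have hr : 0 < s.toReal := ENNReal.toReal_pos (zero_lt_one.trans_le hs).ne' hs'
    have hr' : 0 < 1 / s.toReal := one_div_pos.2 hr
    have hiff : ∀ {A B : ℝ}, 0 ≤ A → 0 ≤ B → A ^ (1 / s.toReal) ≤ B → A ≤ B ^ s.toReal := by
      intro A B hA _ h
      have := Real.rpow_le_rpow (Real.rpow_nonneg hA _) h hr.le
      rwa [← Real.rpow_mul hA, one_div_mul_cancel hr.ne', Real.rpow_one] at this
    have hlam' : ∑ j, ‖lam j‖ ^ s.toReal ≤ 1 := by
      rw [PiLp.norm_eq_sum hr] at hlam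
      simpa using hiff (Finset.sum_nonneg fun j _ => by positivity) zero_le_one hlam
    have hj' : ∀ j, ∑ i, ‖φ j (x i)‖ ^ s.toReal ≤ w ^ s.toReal := fun j => by
      have := hj j
      rw [PiLp.norm_eq_sum hr] at this
      exact hiff (Finset.sum_nonneg fun j _ => by positivity) hw0 this
    have h1 : ∀ i, ‖diagOp s lam φ (x i)‖ ^ s.toReal =
        ∑ j, ‖lam j‖ ^ s.toReal * ‖φ j (x i)‖ ^ s.toReal := by
      intro i
      rw [PiLp.norm_eq_sum hr, ← Real.rpow_mul (Finset.sum_nonneg fun j _ => by positivity),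
        one_div_mul_cancel hr.ne', Real.rpow_one]
      rw [← Equiv.sum_comp (Equiv.ulift : ULift.{v} (Fin n) ≃ Fin n)]
      refine Finset.sum_congr rfl fun j _ => ?_
      rw [diagOp_apply, norm_mul, Complex.norm_real, Real.mul_rpow (norm_nonneg _) (norm_nonneg _)]
      rfl
    rw [PiLp.norm_eq_sum hr]
    have h2 : ∑ i, ‖diagOp s lam φ (x i)‖ ^ s.toReal ≤ w ^ s.toReal := by
      simp_rw [h1]
      rw [Finset.sum_comm]
      calc _ = ∑ j, ‖lam j‖ ^ s.toReal * ∑ i, ‖φ j (x i)‖ ^ s.toReal := by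
            simp_rw [Finset.mul_sum]
        _ ≤ ∑ j, ‖lam j‖ ^ s.toReal * w ^ s.toReal :=
            Finset.sum_le_sum fun j _ => mul_le_mul_of_nonneg_left (hj' j) (by positivity)
        _ ≤ w ^ s.toReal := by
            rw [← Finset.sum_mul]
            exact mul_le_of_le_one_left (by positivity) hlam'
    calc _ ≤ (w ^ s.toReal) ^ (1 / s.toReal) :=
          Real.rpow_le_rpow (Finset.sum_nonneg fun j _ => by positivity) h2 hr'.le
      _ = w := by rw [← Real.rpow_mul hw0, mul_one_div_cancel hr.ne', Real.rpow_one]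

/-- For y_j = T X a_j, let S be the diagonal operator with functionals norming y_j and
Hölder-extremal weights. Then the ℓ_q-norm of (‖y_j‖) equals ∑_k ∑_j a_jk (S T X e_k)_j. Hölder's
inequality in j, Cauchy–Schwarz in k and π_2(ST) ≤ c give the bound. -/
theorem MixBound.of_mixingNorm_le {s : ℝ≥0∞} (hs : 2 ≤ s) {T : E →L[ℂ] F} {c : ℝ} (hc : 0 ≤ c)
    (h : mixingNorm s 2 T ≤ ENNReal.ofReal c) : MixBound (conjInv s) T c := by
  intro m n X a
  have : Fact (1 ≤ s) := ⟨one_le_of_two_le hs⟩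
  have hκ := conjInv_mem hs
  set κ := conjInv s with hκdef
  set y : Fin n → F := fun j => T (X (a j)) with hy
  set A := ∑ j, ‖y j‖ ^ (1 / κ) with hA
  have hR : 0 ≤ c * ‖X‖ * mixedNorm κ a := by
    have : 0 ≤ mixedNorm κ a := norm_nonneg _
    positivity
  have hA0 : 0 ≤ A := Finset.sum_nonneg fun j _ => by positivity
  rcases hA0.eq_or_lt with h0 | hApos
  · rwa [← h0, Real.zero_rpow hκ.1.ne']
  set β : Fin n → ℝ := fun j => ‖y j‖ ^ (1 / κ) / A with hβ
  have hβ0 : ∀ j, 0 ≤ β j := fun j => by positivity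
  have hβsum : ∑ j, β j = 1 := by rw [hβ, ← Finset.sum_div, ← hA, div_self hApos.ne']
  choose φ hφ hφy using fun j => exists_dual_vector'' ℂ (y j)
  set S := diagOp s (fun j => β j ^ (1 - κ)) φ with hS
  have hS1 : summingNorm s s S ≤ 1 :=
    summingNorm_diagOp_le hφ (norm_rpow_weight_le_one hs hβ0 hβsum.le)
  have hST : summingNorm 2 2 (S.comp T) ≤ ENNReal.ofReal c := by
    refine le_trans ?_ h
    -- The target is indexed by `ULift (Fin n)` because the supremum in `mixingNorm` runs over Y in
    -- the universe of F.
    exact le_iSup_of_le (PiLp s fun _ : ULift.{v} (Fin n) => ℂ) (le_iSup_of_le inferInstance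
      (le_iSup_of_le inferInstance (le_iSup_of_le inferInstance
        (le_iSup_of_le S (le_iSup_of_le hS1 le_rfl)))))
  have hbd := norm_le_of_summingNorm_two_le hc hST X
  have h1 : A ^ κ = ∑ j, ‖y j‖ * β j ^ (1 - κ) :=
    (sum_mul_extremal_weight Finset.univ (fun j => norm_nonneg (y j)) hκ hApos).symm
  have h2 : ((A ^ κ : ℝ) : ℂ) = ∑ k, ∑ j, a j k *
      S (T (X (EuclideanSpace.single k 1))) (ULift.up j) := by
    rw [h1, Finset.sum_comm]
    push_cast
    refine Finset.sum_congr rfl fun j _ => ?_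
    have h3 : ((‖y j‖ : ℝ) : ℂ) = φ j (y j) := (hφy j).symm
    have h4 : y j = ∑ k, a j k • T (X (EuclideanSpace.single k 1)) := by
      rw [hy]
      simp only
      rw [← ContinuousLinearMap.coe_coe X, map_eq_sum_single (X : _ →ₗ[ℂ] E) (a j), map_sum]
      simp
    rw [h3, h4, map_sum, Finset.sum_mul]
    refine Finset.sum_congr rfl fun k _ => ?_
    rw [hS, diagOp_apply, map_smul, smul_eq_mul]
    push_cast
    ring
  have h5 : A ^ κ ≤ ∑ k, (∑ j, ‖a j k‖ ^ (1 / κ)) ^ κ *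
      ‖S (T (X (EuclideanSpace.single k 1)))‖ := by
    have h6 : A ^ κ = ‖((A ^ κ : ℝ) : ℂ)‖ := by
      rw [Complex.norm_real, Real.norm_of_nonneg (Real.rpow_nonneg hA0 _)]
    rw [h6, h2]
    refine (norm_sum_le _ _).trans (Finset.sum_le_sum fun k _ => (norm_sum_le _ _).trans ?_)
    simp_rw [norm_mul]
    have h7 := sum_mul_norm_le (ι := ULift.{v} (Fin n)) hs (f := fun j => ‖a j.down k‖)
      (fun j => norm_nonneg _) (S (T (X (EuclideanSpace.single k 1)))).ofLp
    rw [← Equiv.sum_comp (Equiv.ulift : ULift.{v} (Fin n) ≃ Fin n),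
      ← Equiv.sum_comp (Equiv.ulift : ULift.{v} (Fin n) ≃ Fin n)]
    exact h7
  have h8 := cauchy_schwarz_toLp (fun k => (∑ j, ‖a j k‖ ^ (1 / κ)) ^ κ)
    (fun k => S (T (X (EuclideanSpace.single k 1))))
  have h9 : ∀ k, ‖(∑ j, ‖a j k‖ ^ (1 / κ)) ^ κ‖ = (∑ j, ‖a j k‖ ^ (1 / κ)) ^ κ := fun k =>
    Real.norm_of_nonneg (Real.rpow_nonneg (Finset.sum_nonneg fun j _ => by positivity) _)
  simp_rw [h9] at h8
  refine (h5.trans h8).trans ?_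
  rw [mul_comm]
  exact mul_le_mul_of_nonneg_right hbd (norm_nonneg _)

/-- Scaling the vectors turns a weighted sum of r-th powers into an unweighted one, to which the
summing inequality applies. -/
theorem norm_map_rpow_smul {G : Type*} [NormedAddCommGroup G] [NormedSpace ℂ G] (L : F →L[ℂ] G)
    {α r : ℝ} (hα : 0 ≤ α) (hr : r ≠ 0) (y : F) :
    ‖L (((α ^ (1 / r) : ℝ) : ℂ) • y)‖ ^ r = ‖L y‖ ^ r * α := by
  rw [map_smul, norm_smul, Complex.norm_real, Real.norm_of_nonneg (Real.rpow_nonneg hα _),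
    Real.mul_rpow (Real.rpow_nonneg hα _) (norm_nonneg _), ← Real.rpow_mul hα,
    one_div_mul_cancel hr, Real.rpow_one, mul_comm]

/-- A discrete form of Pietsch's domination theorem, for finitely many vectors. -/
theorem exists_finite_domination_of_ne_top {Y : Type*} [NormedAddCommGroup Y] [NormedSpace ℂ Y]
    {s : ℝ≥0∞} (hs : 1 ≤ s) (hs' : s ≠ ∞) {S : F →L[ℂ] Y} (hS : summingNorm s s S ≤ 1) {m : ℕ}
    (y : Fin m → F) {ε : ℝ} (hε : 0 < ε) :
    ∃ (n : ℕ) (β : Fin n → ℝ) (φ : Fin n → StrongDual ℂ F), (∀ j, 0 ≤ β j) ∧ ∑ j, β j = 1 ∧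
      (∀ j, ‖φ j‖ ≤ 1) ∧ ∀ k, ‖S (y k)‖ ^ s.toReal ≤ ∑ j, β j * ‖φ j (y k)‖ ^ s.toReal + ε := by
  have hr : 0 < s.toReal := ENNReal.toReal_pos (zero_lt_one.trans_le hs).ne' hs'
  have hr' : 0 < 1 / s.toReal := one_div_pos.2 hr
  set r := s.toReal with hrdef
  let K : Set (Fin m → ℝ) := {p | ∃ φ : StrongDual ℂ F, ‖φ‖ ≤ 1 ∧ p = fun k => ‖φ (y k)‖ ^ r}
  -- The open lower set below the convex hull of K is convex. If it missed b, Hahn–Banach in ℝ^m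
  -- would separate them. Finite convex combinations take the place of Pietsch's measure, and the
  -- loss ε makes compactness of the dual ball unnecessary.
  let D : Set (Fin m → ℝ) := {p | ∃ c ∈ convexHull ℝ K, ∀ k, p k < c k}
  let b : Fin m → ℝ := fun k => ‖S (y k)‖ ^ r - ε
  suffices hb : b ∈ D by
    obtain ⟨c, hc, hbc⟩ := hb
    obtain ⟨ι, hι, w, z, hw0, hw1, hz, rfl⟩ := mem_convexHull_iff_exists_fintype.1 hc
    choose φ hφ hφz using hz
    let e := (Fintype.equivFin ι).symm
    refine ⟨Fintype.card ι, fun j => w (e j), fun j => φ (e j), fun j => hw0 _, ?_, fun j => hφ _,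
      fun k => ?_⟩
    · rw [Equiv.sum_comp e w, hw1]
    · have h1 := (hbc k).le
      have h2 : (∑ i, w i • z i) k = ∑ i, w i * ‖φ i (y k)‖ ^ r := by
        rw [Finset.sum_apply]
        refine Finset.sum_congr rfl fun i _ => ?_
        rw [Pi.smul_apply, hφz i, smul_eq_mul]
      rw [h2, ← Equiv.sum_comp e] at h1
      simp only [b] at h1
      linarith
  by_contra hb
  have hDo : IsOpen D := by
    have : D = ⋃ c ∈ convexHull ℝ K, {p | ∀ k, p k < c k} := by
      ext p
      simp [D]
    rw [this]
    refine isOpen_biUnion fun c _ => ?_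
    simp only [Set.ofPred_forall]
    exact isOpen_iInter_of_finite fun k => isOpen_lt (continuous_apply k) continuous_const
  have hDc : Convex ℝ D := by
    rintro p ⟨c, hc, hpc⟩ q ⟨d, hd, hqd⟩ α α' hα hα' hsum
    refine ⟨α • c + α' • d, convex_convexHull ℝ K hc hd hα hα' hsum, fun k => ?_⟩
    simp only [Pi.add_apply, Pi.smul_apply, smul_eq_mul]
    rcases hα.eq_or_lt with h0 | hpos
    · have : α' = 1 := by linarith
      simp [← h0, this, hqd k]
    · nlinarith [hpc k, hqd k]
  obtain ⟨f, hf⟩ := geometric_hahn_banach_open_point hDc hDo hb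
  let α : Fin m → ℝ := fun k => f (Pi.single k 1)
  have hfα : ∀ p, f p = ∑ k, p k * α k := fun p => by
    conv_lhs => rw [← Finset.univ_sum_single p]
    rw [map_sum]
    refine Finset.sum_congr rfl fun k _ => ?_
    have : (Pi.single k (p k) : Fin m → ℝ) = p k • Pi.single k 1 := by
      rw [← Pi.single_smul]
      simp
    rw [this, map_smul, smul_eq_mul]
  have hK0 : (0 : Fin m → ℝ) ∈ convexHull ℝ K := by
    refine subset_convexHull ℝ K ⟨0, by simp, ?_⟩
    ext k
    simp [Real.zero_rpow hr.ne']
  -- D is closed under lowering coordinates, so a functional bounded above on D has nonnegative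
  -- coefficients.
  have hα0 : ∀ k, 0 ≤ α k := by
    intro k
    by_contra hk
    push Not at hk
    have h1 : ∀ t : ℝ, 0 ≤ t → f (fun _ => -1) - t * α k < f b := by
      intro t ht
      have h2 : ((fun _ => -1) - t • Pi.single k 1 : Fin m → ℝ) ∈ D := by
        refine ⟨0, hK0, fun i => ?_⟩
        have h3 : 0 ≤ t * (Pi.single k (1 : ℝ) : Fin m → ℝ) i := by
          refine mul_nonneg ht ?_
          rw [Pi.single_apply]
          split_ifs <;> norm_num
        simp only [Pi.sub_apply, Pi.smul_apply, smul_eq_mul, Pi.zero_apply]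
        linarith
      have h4 := hf _ h2
      rwa [map_sub, map_smul, smul_eq_mul] at h4
    have h5 := h1 0 le_rfl
    -- This is the t for which the left side equals f b, contradicting the strict inequality.
    have h6 := h1 ((f b - f fun _ => -1) / (-α k)) (div_nonneg (by linarith) (by linarith))
    have h7 : (f b - f fun _ => -1) / (-α k) * α k = -(f b - f fun _ => -1) := by
      have : α k ≠ 0 := hk.ne
      field_simp
    rw [h7] at h6
    linarith
  have hKle : ∀ φ : StrongDual ℂ F, ‖φ‖ ≤ 1 →
      ∑ k, ‖φ (y k)‖ ^ r * α k ≤ ∑ k, b k * α k := by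
    intro φ hφ
    have hsum : 0 ≤ ∑ k, α k := Finset.sum_nonneg fun k _ => hα0 k
    refine le_of_forall_pos_le_add fun δ hδ => ?_
    set δ' := δ / (∑ k, α k + 1) with hδ'
    have hδ'0 : 0 < δ' := by positivity
    have h1 : (fun k => ‖φ (y k)‖ ^ r - δ') ∈ D :=
      ⟨fun k => ‖φ (y k)‖ ^ r, subset_convexHull ℝ K ⟨φ, hφ, rfl⟩, fun k => by linarith⟩
    have h2 := hf _ h1
    rw [hfα, hfα b] at h2
    simp_rw [sub_mul, Finset.sum_sub_distrib, ← Finset.mul_sum] at h2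
    have h3 : δ' * ∑ k, α k ≤ δ := by
      rw [hδ', div_mul_eq_mul_div, div_le_iff₀ (by positivity)]
      nlinarith
    linarith
  set M := ∑ k, b k * α k with hM
  have hM0 : 0 ≤ M := by
    have := hKle 0 (by simp)
    simpa [Real.zero_rpow hr.ne'] using this
  let x : Fin m → F := fun k => ((α k ^ (1 / r) : ℝ) : ℂ) • y k
  have hweak : weakLpNorm s x ≤ ENNReal.ofReal (M ^ (1 / r)) := by
    refine weakLpNorm_le fun φ hφ => ?_
    rw [PiLp.norm_eq_sum hr]
    refine Real.rpow_le_rpow (Finset.sum_nonneg fun k _ => by positivity) ?_ hr'.le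
    simp only [← hrdef, norm_map_rpow_smul φ (hα0 _) hr.ne', x]
    exact hKle φ hφ
  have h1 := (norm_le_of_summingNorm_le hs (C := 1) (by simpa using hS) x)
  rw [ENNReal.coe_one, one_mul] at h1
  have h2 := h1.trans hweak
  rw [ENNReal.ofReal_le_ofReal_iff (by positivity), PiLp.norm_eq_sum hr,
    Real.rpow_le_rpow_iff (Finset.sum_nonneg fun k _ => by positivity) hM0 hr'] at h2
  simp only [← hrdef, norm_map_rpow_smul S (hα0 _) hr.ne', x] at h2
  simp only [hM, b, sub_mul, Finset.sum_sub_distrib, ← Finset.mul_sum] at h2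
  -- The summing inequality for α_k^{1/r} y_k reads ∑ α_k ‖S y_k‖^r ≤ ∑ α_k (‖S y_k‖^r - ε). It
  -- forces α = 0, so f vanishes and cannot separate strictly.
  have h3 : ∑ k, α k ≤ 0 := by nlinarith
  have h4 : ∀ k, α k = 0 := fun k =>
    (Finset.sum_eq_zero_iff_of_nonneg (fun k _ => hα0 k)).1
      (le_antisymm h3 (Finset.sum_nonneg fun k _ => hα0 k)) k (Finset.mem_univ k)
  have h5 := hf _ (show (fun _ => -1 : Fin m → ℝ) ∈ D from ⟨0, hK0, fun k => by simp⟩)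
  rw [hfα, hfα b] at h5
  simp [h4] at h5

/-- Pietsch's measure with masses β_j becomes a diagonal operator with entries β_j^{1/s}. For s = ∞
it suffices that S is a contraction: functionals norming the given vectors, with all entries 1, do
the work. -/
theorem exists_finite_domination {Y : Type*} [NormedAddCommGroup Y] [NormedSpace ℂ Y]
    {s : ℝ≥0∞} (hs : 2 ≤ s) {S : F →L[ℂ] Y} (hS : summingNorm s s S ≤ 1) {m : ℕ}
    (y : Fin m → F) {ε : ℝ} (hε : 0 < ε) :
    ∃ (n : ℕ) (lam : Fin n → ℝ) (φ : Fin n → StrongDual ℂ F), (∀ j, 0 ≤ lam j) ∧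
      (∀ j, ‖φ j‖ ≤ 1) ∧ ‖(WithLp.toLp s lam : PiLp s fun _ : Fin n => ℝ)‖ ≤ 1 ∧
      ∀ k, ‖S (y k)‖ ≤ ‖(WithLp.toLp s (fun j => (lam j : ℂ) * φ j (y k)) :
        PiLp s fun _ : Fin n => ℂ)‖ + ε := by
  rcases eq_or_ne s ∞ with rfl | hs'
  · choose φ hφ hφy using fun k => exists_dual_vector'' ℂ (y k)
    refine ⟨m, fun _ => 1, φ, fun _ => zero_le_one, hφ, ?_, fun k => ?_⟩
    · rw [PiLp.norm_eq_ciSup]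
      exact Real.iSup_le (fun j => by simp) zero_le_one
    · have h1 := norm_apply_le_of_summingNorm_le_one (one_le_of_two_le hs) hS (y k)
      have h2 := PiLp.norm_apply_le (WithLp.toLp ∞ (fun j => ((1 : ℝ) : ℂ) * φ j (y k)) :
        PiLp ∞ fun _ : Fin m => ℂ) k
      simp only [Complex.ofReal_one, one_mul, hφy k, Complex.coe_algebraMap, Complex.norm_real,
        norm_norm] at h2 ⊢
      linarith
  · have h2 := two_le_toReal hs hs'
    have hr : 0 < s.toReal := by linarith
    have hr' : 0 < 1 / s.toReal := one_div_pos.2 hr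
    -- The error ε^s turns into ε under the s-th root, by subadditivity of t ↦ t^{1/s}.
    obtain ⟨n, β, φ, hβ0, hβ1, hφ, hdom⟩ := exists_finite_domination_of_ne_top
      (one_le_of_two_le hs) hs' hS y (Real.rpow_pos_of_pos hε s.toReal)
    refine ⟨n, fun j => β j ^ (1 - conjInv s), φ, fun j => Real.rpow_nonneg (hβ0 j) _, hφ,
      norm_rpow_weight_le_one hs hβ0 hβ1.le, fun k => ?_⟩
    have h3 : ∀ j, ‖((β j ^ (1 - conjInv s) : ℝ) : ℂ) * φ j (y k)‖ ^ s.toReal =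
        β j * ‖φ j (y k)‖ ^ s.toReal := fun j => by
      rw [norm_mul, Complex.norm_real, Real.norm_of_nonneg (Real.rpow_nonneg (hβ0 j) _),
        Real.mul_rpow (Real.rpow_nonneg (hβ0 j) _) (norm_nonneg _), ← Real.rpow_mul (hβ0 j),
        conjInv_eq, sub_sub_cancel, one_div_mul_cancel hr.ne', Real.rpow_one]
    rw [PiLp.norm_eq_sum hr]
    simp only [h3]
    have hA : 0 ≤ ∑ j, β j * ‖φ j (y k)‖ ^ s.toReal :=
      Finset.sum_nonneg fun j _ => mul_nonneg (hβ0 j) (by positivity)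
    calc ‖S (y k)‖ = (‖S (y k)‖ ^ s.toReal) ^ (1 / s.toReal) := by
          rw [← Real.rpow_mul (norm_nonneg _), mul_one_div_cancel hr.ne', Real.rpow_one]
      _ ≤ (∑ j, β j * ‖φ j (y k)‖ ^ s.toReal + ε ^ s.toReal) ^ (1 / s.toReal) :=
          Real.rpow_le_rpow (by positivity) (hdom k) hr'.le
      _ ≤ (∑ j, β j * ‖φ j (y k)‖ ^ s.toReal) ^ (1 / s.toReal) +
          (ε ^ s.toReal) ^ (1 / s.toReal) :=
          Real.rpow_add_le_add_rpow hA (by positivity) hr'.le (by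
            rw [div_le_one hr]; linarith)
      _ = _ := by
          rw [← Real.rpow_mul hε.le, mul_one_div_cancel hr.ne', Real.rpow_one]

/-- Domination replaces S on the vectors T X e_k by a diagonal operator with entries λ_j and
functionals φ_j. The ℓ_2-norm R of the resulting norms N_k is then computed by duality: R² = ∑_j λ_j
φ_j(T X a_j) for a suitable family a of mixed norm at most R. Hölder's inequality and the bilinear
bound yield R² ≤ c‖X‖R. -/
theorem MixBound.mixingNorm_le {s : ℝ≥0∞} (hs : 2 ≤ s) {T : E →L[ℂ] F} {c : ℝ} (hc : 0 ≤ c)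
    (h : MixBound (conjInv s) T c) : mixingNorm s 2 T ≤ ENNReal.ofReal c := by
  refine iSup_le fun Y => iSup_le fun _ => iSup_le fun _ => iSup_le fun _ => iSup_le fun S =>
    iSup_le fun hS => summingNorm_two_le hc fun m X => ?_
  have hs1 : Fact (1 ≤ s) := ⟨one_le_of_two_le hs⟩
  have hκ := conjInv_mem hs
  set κ := conjInv s with hκdef
  set x : Fin m → E := fun k => X (EuclideanSpace.single k 1) with hx
  have key : ∀ ε : ℝ, 0 < ε →
      ‖(WithLp.toLp 2 (fun k => S (T (x k))) : PiLp 2 fun _ : Fin m => Y)‖ ≤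
        c * ‖X‖ + ε * ‖(WithLp.toLp 2 (fun _ => 1) : PiLp 2 fun _ : Fin m => ℝ)‖ := by
    intro ε hε
    obtain ⟨n, lam, φ, hlam0, hφ, hlam, hdom⟩ :=
      exists_finite_domination hs hS (fun k => T (x k)) hε
    set N : Fin m → ℝ := fun k => ‖(WithLp.toLp s (fun j => (lam j : ℂ) * φ j (T (x k))) :
        PiLp s fun _ : Fin n => ℂ)‖ with hN
    have hN0 : ∀ k, 0 ≤ N k := fun k => norm_nonneg _
    choose f hf1 hfN using fun k => exists_extremal hs fun j => (lam j : ℂ) * φ j (T (x k))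
    set R := ‖(WithLp.toLp 2 N : PiLp 2 fun _ : Fin m => ℝ)‖ with hR
    have hR0 : 0 ≤ R := norm_nonneg _
    have hRsq : R ^ 2 = ∑ k, N k ^ 2 := by
      rw [hR, PiLp.norm_sq_eq_of_L2]
      simp
    -- For each k the sequence f_k is extremal in ℓ_q^n and recovers N_k; the further factor N_k is
    -- extremal for the ℓ_2-sum over k.
    let a : Fin n → EuclideanSpace ℂ (Fin m) := fun j => WithLp.toLp 2 fun k => (N k : ℂ) * f k j
    have ha : mixedNorm κ a ≤ R := by
      refine PiLp.norm_le_norm_of_forall (one_le_of_two_le le_rfl) fun k => ?_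
      have h1 : 0 ≤ (∑ j, ‖a j k‖ ^ (1 / κ)) ^ κ :=
        Real.rpow_nonneg (Finset.sum_nonneg fun j _ => by positivity) _
      rw [Real.norm_of_nonneg h1, Real.norm_of_nonneg (hN0 k)]
      have h2 : ∀ j, ‖a j k‖ ^ (1 / κ) = N k ^ (1 / κ) * ‖f k j‖ ^ (1 / κ) := fun j => by
        change ‖(N k : ℂ) * f k j‖ ^ (1 / κ) = _
        rw [norm_mul, Complex.norm_real, Real.norm_of_nonneg (hN0 k),
          Real.mul_rpow (hN0 k) (norm_nonneg _)]
      simp_rw [h2, ← Finset.mul_sum]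
      rw [Real.mul_rpow (Real.rpow_nonneg (hN0 k) _)
        (Finset.sum_nonneg fun j _ => by positivity), ← Real.rpow_mul (hN0 k),
        one_div_mul_cancel hκ.1.ne', Real.rpow_one]
      exact mul_le_of_le_one_right (hN0 k) (hf1 k)
    have hpair : ((R ^ 2 : ℝ) : ℂ) = ∑ j, (lam j : ℂ) * φ j (T (X (a j))) := by
      have h1 : ∀ j, T (X (a j)) = ∑ k, ((N k : ℂ) * f k j) • T (x k) := fun j => by
        rw [← ContinuousLinearMap.coe_coe X, map_eq_sum_single (X : _ →ₗ[ℂ] E) (a j), map_sum]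
        simp [a, hx]
      simp_rw [h1, map_sum, map_smul, Finset.mul_sum]
      rw [Finset.sum_comm, hRsq]
      push_cast
      refine Finset.sum_congr rfl fun k _ => ?_
      rw [sq]
      nth_rewrite 2 [hN]
      simp only
      rw [← hfN k, Finset.mul_sum]
      refine Finset.sum_congr rfl fun j _ => ?_
      rw [smul_eq_mul]
      ring
    have hR2 : R ^ 2 ≤ c * ‖X‖ * R := by
      have h1 : R ^ 2 = ‖((R ^ 2 : ℝ) : ℂ)‖ := by
        rw [Complex.norm_real, Real.norm_of_nonneg (sq_nonneg R)]
      rw [h1, hpair]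
      calc ‖∑ j, (lam j : ℂ) * φ j (T (X (a j)))‖ ≤ ∑ j, ‖T (X (a j))‖ * ‖lam j‖ := by
            refine (norm_sum_le _ _).trans (Finset.sum_le_sum fun j _ => ?_)
            rw [norm_mul, Complex.norm_real, mul_comm]
            refine mul_le_mul_of_nonneg_right (((φ j).le_opNorm _).trans ?_) (norm_nonneg _)
            exact mul_le_of_le_one_left (norm_nonneg _) (hφ j)
        _ ≤ (∑ j, ‖T (X (a j))‖ ^ (1 / κ)) ^ κ *
            ‖(WithLp.toLp s lam : PiLp s fun _ : Fin n => ℝ)‖ :=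
            sum_mul_norm_le hs (fun j => norm_nonneg _) lam
        _ ≤ (∑ j, ‖T (X (a j))‖ ^ (1 / κ)) ^ κ :=
            mul_le_of_le_one_right (Real.rpow_nonneg (Finset.sum_nonneg fun j _ => by
              positivity) _) hlam
        _ ≤ c * ‖X‖ * mixedNorm κ a := h m n X a
        _ ≤ c * ‖X‖ * R := mul_le_mul_of_nonneg_left ha (by positivity)
    have hRle : R ≤ c * ‖X‖ := by
      rcases hR0.eq_or_lt with h0 | hpos
      · rw [← h0]
        positivity
      · rw [sq] at hR2
        exact le_of_mul_le_mul_right hR2 hpos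
    calc ‖(WithLp.toLp 2 (fun k => S (T (x k))) : PiLp 2 fun _ : Fin m => Y)‖
        ≤ ‖(WithLp.toLp 2 (fun k => N k + ε * 1) : PiLp 2 fun _ : Fin m => ℝ)‖ := by
          refine PiLp.norm_le_norm_of_forall (one_le_of_two_le le_rfl) fun k => ?_
          rw [mul_one, Real.norm_of_nonneg (add_nonneg (hN0 k) hε.le)]
          exact hdom k
      _ ≤ R + ‖ε • (WithLp.toLp 2 (fun _ => 1) : PiLp 2 fun _ : Fin m => ℝ)‖ := by
          have hsplit : (WithLp.toLp 2 (fun k => N k + ε * 1) : PiLp 2 fun _ : Fin m => ℝ) =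
              WithLp.toLp 2 N + ε • (WithLp.toLp 2 (fun _ => 1) : PiLp 2 fun _ : Fin m => ℝ) := by
            ext k
            simp
          rw [hsplit]
          exact norm_add_le _ _
      _ ≤ _ := by
          rw [norm_smul, Real.norm_of_nonneg hε.le]
          linarith
  have hlim : Tendsto (fun ε : ℝ => c * ‖X‖ + ε *
      ‖(WithLp.toLp 2 (fun _ => 1) : PiLp 2 fun _ : Fin m => ℝ)‖) (𝓝[>] 0) (𝓝 (c * ‖X‖)) := by
    have hcont : Continuous fun ε : ℝ => c * ‖X‖ + ε *
      ‖(WithLp.toLp 2 (fun _ => 1) : PiLp 2 fun _ : Fin m => ℝ)‖ := by fun_prop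
    have := hcont.tendsto 0
    simp only [zero_mul, add_zero] at this
    exact this.mono_left nhdsWithin_le_nhds
  refine ge_of_tendsto hlim ?_
  filter_upwards [self_mem_nhdsWithin] with ε hε using key ε hε

/-- Operators on finite-dimensional spaces are mixing. -/
theorem mixingNorm_ne_top [FiniteDimensional ℂ E] {s : ℝ≥0∞} (hs : 2 ≤ s) (T : E →L[ℂ] F) :
    mixingNorm s 2 T ≠ ∞ := by
  let b := Module.finBasis ℂ E
  let φ : Fin (Module.finrank ℂ E) → StrongDual ℂ E := fun i =>
    LinearMap.toContinuousLinearMap (b.coord i)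
  set C := ∑ i, ‖T (b i)‖ * ‖φ i‖ with hC
  have hC0 : 0 ≤ C := Finset.sum_nonneg fun i _ => by positivity
  refine ne_top_of_le_ne_top (ENNReal.ofReal_ne_top (r := C)) ?_
  refine iSup_le fun Y => iSup_le fun _ => iSup_le fun _ => iSup_le fun _ => iSup_le fun S =>
    iSup_le fun hS => summingNorm_two_le hC0 fun m X => ?_
  let ψ : Fin (Module.finrank ℂ E) → PiLp 2 fun _ : Fin m => ℂ := fun i =>
    WithLp.toLp 2 fun k => φ i (X (EuclideanSpace.single k 1))
  let N : Fin (Module.finrank ℂ E) → PiLp 2 fun _ : Fin m => ℝ := fun i =>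
    WithLp.toLp 2 fun k => ‖ψ i k‖
  have hN : ∀ i, ‖N i‖ ≤ ‖φ i‖ * ‖X‖ := fun i => by
    refine (PiLp.norm_le_norm_of_forall (b := fun k => ψ i k) (one_le_of_two_le le_rfl)
      fun k => (norm_norm _).le).trans ?_
    exact (norm_toLp_apply_single ((φ i).comp X)).le.trans
      (ContinuousLinearMap.opNorm_comp_le _ _)
  calc ‖(WithLp.toLp 2 fun k => (S.comp T) (X (EuclideanSpace.single k 1)) :
        PiLp 2 fun _ : Fin m => Y)‖
      ≤ ‖∑ i, ‖T (b i)‖ • N i‖ := by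
        have hsum : (∑ i, ‖T (b i)‖ • N i) = (WithLp.toLp 2 fun k => ∑ i, ‖T (b i)‖ * ‖ψ i k‖ :
            PiLp 2 fun _ : Fin m => ℝ) := by
          ext k
          simp [N]
        rw [hsum]
        refine PiLp.norm_le_norm_of_forall (one_le_of_two_le le_rfl) fun k => ?_
        refine le_trans ?_ (le_abs_self _)
        have hxk : X (EuclideanSpace.single k 1) = ∑ i, ψ i k • b i :=
          (b.sum_repr (X (EuclideanSpace.single k 1))).symm
        -- Nothing but the contractivity of S is used, so the bound C is uniform in S and Y.
        refine (norm_apply_le_of_summingNorm_le_one (one_le_of_two_le hs) hS _).trans ?_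
        rw [hxk, map_sum]
        refine (norm_sum_le _ _).trans (Finset.sum_le_sum fun i _ => ?_)
        rw [map_smul, norm_smul, mul_comm]
        exact le_rfl
    _ ≤ ∑ i, ‖T (b i)‖ * (‖φ i‖ * ‖X‖) := by
        refine (norm_sum_le _ _).trans (Finset.sum_le_sum fun i _ => ?_)
        rw [norm_smul, norm_norm]
        exact mul_le_mul_of_nonneg_left (hN i) (norm_nonneg _)
    _ = C * ‖X‖ := by
        rw [hC, Finset.sum_mul]
        simp_rw [mul_assoc]

end Mixing

/-! ### Interpolation of mixing operators -/

theorem norm_exp_interpolate (κ₀ κ₁ κ ℓ : ℝ) (z : ℂ) :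
    ‖Complex.exp (((1 - z) * κ₀ + z * κ₁) * ((ℓ / κ : ℝ) : ℂ))‖ =
      Real.exp (ℓ * (((1 - z.re) * κ₀ + z.re * κ₁) / κ)) := by
  rw [Complex.norm_exp, Complex.re_mul_ofReal, re_interpolate]
  congr 1
  ring

/-- The extremal function for the interpolation of `ℓ_q`-norms. -/
theorem exists_entire_lp {n : ℕ} (a : Fin n → ℂ) {κ₀ κ₁ κ θ : ℝ}
    (hκ₀ : κ₀ ∈ Set.Ioc (0 : ℝ) 1) (hκ₁ : κ₁ ∈ Set.Ioc (0 : ℝ) 1)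
    (hκ : κ = (1 - θ) * κ₀ + θ * κ₁) (hκ' : κ ∈ Set.Ioc (0 : ℝ) 1) :
    ∃ A : Fin n → ℂ → ℂ, (∀ j, Differentiable ℂ (A j)) ∧
      (∀ j, ∃ B : ℝ, ∀ z : ℂ, z.re ∈ Set.Icc (0 : ℝ) 1 → ‖A j z‖ ≤ B) ∧
      (∀ j, A j θ = a j) ∧
      (∀ t : ℝ, (∑ j, ‖A j (t * Complex.I)‖ ^ (1 / κ₀)) ^ κ₀ ≤ (∑ j, ‖a j‖ ^ (1 / κ)) ^ κ) ∧
      ∀ t : ℝ, (∑ j, ‖A j (1 + t * Complex.I)‖ ^ (1 / κ₁)) ^ κ₁ ≤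
        (∑ j, ‖a j‖ ^ (1 / κ)) ^ κ := by
  have hq : 0 < 1 / κ := one_div_pos.2 hκ'.1
  set Q := ∑ j, ‖a j‖ ^ (1 / κ) with hQ
  have hQ0 : 0 ≤ Q := Finset.sum_nonneg fun j _ => by positivity
  set r := Q ^ κ with hr
  have hr0 : 0 ≤ r := Real.rpow_nonneg hQ0 _
  have hrQ : r ^ (1 / κ) = Q := by
    rw [hr, ← Real.rpow_mul hQ0, mul_one_div_cancel hκ'.1.ne', Real.rpow_one]
  have hale : ∀ j, ‖a j‖ ≤ r := fun j => by
    rw [← Real.rpow_le_rpow_iff (norm_nonneg _) hr0 hq, hrQ]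
    exact Finset.single_le_sum (f := fun j => ‖a j‖ ^ (1 / κ)) (fun i _ => by positivity)
      (Finset.mem_univ j)
  -- This is sgn(a_j) r (|a_j|/r)^{κ(z)/κ} with κ(z) = (1-z)κ₀ + zκ₁ and r the ℓ_q-norm of a.
  -- Dividing by r makes the base at most 1, hence A_j is bounded on the strip. For a_j = 0 the
  -- phase a_j/‖a_j‖ is 0 and so is A_j.
  set A : Fin n → ℂ → ℂ := fun j z => a j / ‖a j‖ * r *
    Complex.exp (((1 - z) * κ₀ + z * κ₁) * ((Real.log (‖a j‖ / r) / κ : ℝ) : ℂ)) with hA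
  have hnorm : ∀ j z, a j ≠ 0 → ‖A j z‖ =
      r * (‖a j‖ / r) ^ (((1 - z.re) * κ₀ + z.re * κ₁) / κ) := by
    intro j z hj
    have hpos := norm_pos_iff.2 hj
    have hrpos : 0 < r := hpos.trans_le (hale j)
    rw [hA, norm_mul, norm_mul, norm_div, Complex.norm_real, Complex.norm_real, norm_norm,
      div_self hpos.ne', one_mul, Real.norm_of_nonneg hr0, norm_exp_interpolate,
      Real.rpow_def_of_pos (div_pos hpos hrpos)]
  have hzero : ∀ j z, a j = 0 → A j z = 0 := fun j z hj => by simp [hA, hj]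
  have hbdry : ∀ {κ' : ℝ} (_ : 0 < κ') {z : ℂ} (_ : (1 - z.re) * κ₀ + z.re * κ₁ = κ'),
      (∑ j, ‖A j z‖ ^ (1 / κ')) ^ κ' ≤ r := by
    intro κ' hκp z hz
    have hq' : 0 < 1 / κ' := one_div_pos.2 hκp
    rcases hr0.eq_or_lt with h0 | hrpos
    · have h1 : ∀ j, A j z = 0 := fun j => hzero j z (by
        have := hale j
        rw [← h0] at this
        exact norm_le_zero_iff.1 this)
      simp only [h1, norm_zero, Real.zero_rpow hq'.ne', Finset.sum_const_zero,
        Real.zero_rpow hκp.ne']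
      exact hr0
    · have h1 : ∀ j, ‖A j z‖ ^ (1 / κ') = r ^ (1 / κ') * (‖a j‖ ^ (1 / κ) / Q) := by
        intro j
        rcases eq_or_ne (a j) 0 with hj | hj
        · rw [hzero j z hj, hj, norm_zero, Real.zero_rpow hq'.ne', Real.zero_rpow hq.ne']
          simp
        · have hpos := norm_pos_iff.2 hj
          have hd := (div_pos hpos hrpos).le
          rw [hnorm j z hj, hz, Real.mul_rpow hr0 (Real.rpow_nonneg hd _), ← Real.rpow_mul hd]
          have h2 : κ' / κ * (1 / κ') = 1 / κ := by field_simp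
          rw [h2, Real.div_rpow (norm_nonneg _) hr0, hrQ]
      have hQpos : 0 < Q := by rw [← hrQ]; exact Real.rpow_pos_of_pos hrpos _
      simp_rw [h1]
      rw [← Finset.mul_sum, ← Finset.sum_div, ← hQ, div_self hQpos.ne', mul_one,
        ← Real.rpow_mul hr0, one_div_mul_cancel hκp.ne', Real.rpow_one]
  refine ⟨A, fun j => ?_, fun j => ⟨r, fun z hz => ?_⟩, fun j => ?_, fun t => ?_, fun t => ?_⟩
  · rw [hA]
    fun_prop
  · rcases eq_or_ne (a j) 0 with hj | hj
    · rw [hzero j z hj, norm_zero]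
      exact hr0
    · have hpos := norm_pos_iff.2 hj
      have hrpos : 0 < r := hpos.trans_le (hale j)
      rw [hnorm j z hj]
      refine mul_le_of_le_one_right hr0 (Real.rpow_le_one (by positivity)
        ((div_le_one hrpos).2 (hale j)) (div_nonneg ?_ hκ'.1.le))
      exact add_nonneg (mul_nonneg (by linarith [hz.2]) hκ₀.1.le) (mul_nonneg hz.1 hκ₁.1.le)
  · rcases eq_or_ne (a j) 0 with hj | hj
    · rw [hzero j _ hj, hj]
    · have hpos := norm_pos_iff.2 hj
      have hrpos : 0 < r := hpos.trans_le (hale j)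
      have h1 : (((1 - (θ : ℂ)) * κ₀ + θ * κ₁) * ((Real.log (‖a j‖ / r) / κ : ℝ) : ℂ)) =
          ((Real.log (‖a j‖ / r) : ℝ) : ℂ) := by
        have h2 : ((1 - (θ : ℂ)) * κ₀ + θ * κ₁) = (κ : ℂ) := by rw [hκ]; push_cast; ring
        rw [h2]
        have : (κ : ℂ) ≠ 0 := by exact_mod_cast hκ'.1.ne'
        push_cast
        field_simp
      rw [hA]
      simp only
      rw [h1, ← Complex.ofReal_exp, Real.exp_log (div_pos hpos hrpos)]
      have h3 : (r : ℂ) ≠ 0 := by exact_mod_cast hrpos.ne'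
      have h4 : (‖a j‖ : ℂ) ≠ 0 := by exact_mod_cast hpos.ne'
      push_cast
      field_simp
  · exact hbdry hκ₀.1 (by simp)
  · exact hbdry hκ₁.1 (by simp)

/-! ### Interpolation of the bilinear bound. -/

namespace CNorm

variable {V : Type u} {W : Type v} [AddCommGroup V] [Module ℂ V] [AddCommGroup W] [Module ℂ W]

theorem Admissible.map [FiniteDimensional ℂ V] {E₀ E₁ : CNorm V} {f : ℂ → V}
    (hf : Admissible E₀ E₁ f) (L : V →ₗ[ℂ] W) (F₀ F₁ : CNorm W) :
    Admissible F₀ F₁ fun z => L (f z) where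
  diffContOnCl := (op L E₀ F₀).differentiable.comp_diffContOnCl hf.diffContOnCl
  bounded := by
    obtain ⟨C, hC⟩ := hf.bounded
    refine ⟨‖op L E₀ F₀‖ * C, fun z hz => ((op L E₀ F₀).le_opNorm _).trans ?_⟩
    exact mul_le_mul_of_nonneg_left (hC z hz) (norm_nonneg _)
  tendsto_left := by
    have := ((op L E₀ F₀).continuous.tendsto 0).comp hf.tendsto_left
    rwa [map_zero] at this
  tendsto_right := by
    have := ((op L E₁ F₁).continuous.tendsto 0).comp hf.tendsto_right
    rwa [map_zero] at this

theorem Admissible.zero (E₀ E₁ : CNorm V) : Admissible E₀ E₁ (fun _ => 0) where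
  diffContOnCl := by
    simp only [map_zero]
    exact diffContOnCl_const
  bounded := ⟨0, fun z _ => by simp⟩
  tendsto_left := by simp
  tendsto_right := by simp

theorem Admissible.sum {E₀ E₁ : CNorm V} {ι : Type*} (s : Finset ι) {f : ι → ℂ → V}
    (hf : ∀ i, Admissible E₀ E₁ (f i)) : Admissible E₀ E₁ fun z => ∑ i ∈ s, f i z := by
  classical
  induction s using Finset.induction_on with
  | empty => simpa using Admissible.zero E₀ E₁
  | insert i s hi ih =>
    simp only [Finset.sum_insert hi]
    exact (hf i).add ih

/-- The `m`-th norm in the definition of `dConst`. -/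
def dNorm [FiniteDimensional ℂ V] (θ : unitInterval) (E₀ E₁ : CNorm V) (m : ℕ) : ℝ :=
  ‖op (LinearMap.id : (EuclideanSpace ℂ (Fin m) →ₗ[ℂ] V) →ₗ[ℂ] _)
    (hilbertOp m (interp θ E₀ E₁)) (interp θ (hilbertOp m E₀) (hilbertOp m E₁))‖

/-- With norms appearing only as seminorms on the bare spaces, one X and one T can be measured for
E₀, E₁ and E_θ alike. -/
theorem mixBound_op_iff [FiniteDimensional ℂ V] {κ c : ℝ} {T : V →ₗ[ℂ] W} {E : CNorm V}
    {F : CNorm W} : MixBound κ (op T E F) c ↔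
      ∀ (m n : ℕ) (X : EuclideanSpace ℂ (Fin m) →ₗ[ℂ] V) (a : Fin n → EuclideanSpace ℂ (Fin m)),
        (∑ j, F.toSeminorm (T (X (a j))) ^ (1 / κ)) ^ κ ≤
          c * (hilbertOp m E).toSeminorm X * mixedNorm κ a := by
  constructor
  · intro h m n X a
    exact h m n (LinearMap.toContinuousLinearMap (E.toSpace.toLinearMap ∘ₗ X)) a
  · intro h m n X a
    exact h m n (E.toSpace.symm.toLinearMap ∘ₗ X.toLinearMap) a

/-- Interpolation of the bilinear maps `(X, a) ↦ (T X a_j)_j`. -/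
theorem interp_mixBound_aux [FiniteDimensional ℂ V] [FiniteDimensional ℂ W]
    {E₀ E₁ : CNorm V} {F₀ F₁ : CNorm W} {θ : unitInterval} {κ₀ κ₁ κ c₀ c₁ : ℝ}
    (hκ₀ : κ₀ ∈ Set.Ioc (0 : ℝ) 1) (hκ₁ : κ₁ ∈ Set.Ioc (0 : ℝ) 1)
    (hκ : κ = (1 - (θ : ℝ)) * κ₀ + (θ : ℝ) * κ₁) (hκ' : κ ∈ Set.Ioc (0 : ℝ) 1)
    (hc₀ : 0 < c₀) (hc₁ : 0 < c₁) {T : V →ₗ[ℂ] W} (h₀ : MixBound κ₀ (op T E₀ F₀) c₀)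
    (h₁ : MixBound κ₁ (op T E₁ F₁) c₁) {m n : ℕ} {Z : ℂ → EuclideanSpace ℂ (Fin m) →ₗ[ℂ] V}
    (hZ : Admissible (hilbertOp m E₀) (hilbertOp m E₁) Z) {D : ℝ} (hD : 0 < D)
    (hZD : stripNorm (hilbertOp m E₀) (hilbertOp m E₁) Z ≤ D)
    (a : Fin n → EuclideanSpace ℂ (Fin m)) (ha : 0 < mixedNorm κ a) :
    (∑ j, interpFun θ F₀ F₁ (T (Z ((θ : ℝ) : ℂ) (a j))) ^ (1 / κ)) ^ κ ≤
      c₀ ^ (1 - (θ : ℝ)) * c₁ ^ (θ : ℝ) * D * mixedNorm κ a := by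
  choose A hAd hAb hAθ hA₀ hA₁ using fun k : Fin m =>
    exists_entire_lp (fun j => a j k) hκ₀ hκ₁ hκ hκ'
  set R := mixedNorm κ a with hR
  set aF : ℂ → Fin n → EuclideanSpace ℂ (Fin m) := fun z j => WithLp.toLp 2 fun k => A k j z
    with haF
  have haθ : ∀ j, aF ((θ : ℝ) : ℂ) j = a j := fun j => by
    ext k
    exact hAθ k j
  have hmono : ∀ {κ' : ℝ} {z : ℂ}, (∀ k, (∑ j, ‖A k j z‖ ^ (1 / κ')) ^ κ' ≤
      (∑ j, ‖a j k‖ ^ (1 / κ)) ^ κ) → mixedNorm κ' (aF z) ≤ R := by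
    intro κ' z h
    refine PiLp.norm_le_norm_of_forall (one_le_of_two_le le_rfl) fun k => ?_
    rw [Real.norm_of_nonneg (Real.rpow_nonneg (Finset.sum_nonneg fun j _ => by positivity) _),
      Real.norm_of_nonneg (Real.rpow_nonneg (Finset.sum_nonneg fun j _ => by positivity) _)]
    exact h k
  -- This is c₀^{z-1} c₁^{-z} / (DR), which cancels the bounds c_i D R on the two lines; the factor
  -- 1/1 puts it in the form of `norm_exp_interpolate`.
  set g : ℂ → ℂ := fun z => (((D * R)⁻¹ : ℝ) : ℂ) *
    Complex.exp (((1 - z) * (-Real.log c₀ : ℝ) + z * (-Real.log c₁ : ℝ)) * ((1 / 1 : ℝ) : ℂ))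
    with hg
  have hgn : ∀ z, ‖g z‖ = (D * R)⁻¹ *
      Real.exp ((1 - z.re) * (-Real.log c₀) + z.re * (-Real.log c₁)) := fun z => by
    rw [hg, norm_mul, norm_exp_interpolate, Complex.norm_real,
      Real.norm_of_nonneg (inv_nonneg.2 (by positivity))]
    simp
  have hgd : Differentiable ℂ g := by
    rw [hg]
    fun_prop
  have hgb : ∃ B : ℝ, ∀ z : ℂ, z.re ∈ Set.Icc (0 : ℝ) 1 → ‖g z‖ ≤ B := by
    refine ⟨(D * R)⁻¹ * Real.exp (|Real.log c₀| + |Real.log c₁|), fun z hz => ?_⟩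
    rw [hgn]
    refine mul_le_mul_of_nonneg_left (Real.exp_le_exp.2 (add_le_add ?_ ?_)) (by positivity)
    · calc (1 - z.re) * -Real.log c₀ ≤ (1 - z.re) * |Real.log c₀| :=
            mul_le_mul_of_nonneg_left (neg_le_abs _) (by linarith [hz.2])
        _ ≤ |Real.log c₀| := mul_le_of_le_one_left (abs_nonneg _) (by linarith [hz.1])
    · calc z.re * -Real.log c₁ ≤ z.re * |Real.log c₁| :=
            mul_le_mul_of_nonneg_left (neg_le_abs _) hz.1
        _ ≤ |Real.log c₁| := mul_le_of_le_one_left (abs_nonneg _) hz.2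
  set h : Fin n → ℂ → W := fun j z => g z • T (Z z (aF z j)) with hh
  have hadm : ∀ j, Admissible F₀ F₁ (h j) := by
    intro j
    refine Admissible.mul_fun ?_ hgd.diffContOnCl hgb
    -- In coordinates the bilinear expression is a finite sum of bounded scalar functions times
    -- linear images of the Calderón function Z.
    have h1 : (fun z => T (Z z (aF z j))) = fun z => ∑ k, A k j z •
        T (Z z (EuclideanSpace.single k 1)) := by
      ext z
      rw [map_eq_sum_single (Z z), map_sum]
      simp [haF]
    rw [h1]
    refine Admissible.sum _ fun k => Admissible.mul_fun ?_ (hAd k j).diffContOnCl (hAb k j)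
    exact hZ.map (T ∘ₗ LinearMap.applyₗ (EuclideanSpace.single k 1)) F₀ F₁
  have hbdry : ∀ (E : CNorm V) (F : CNorm W) {κ' c : ℝ} (z : ℂ), 0 < κ' → 0 < c →
      MixBound κ' (op T E F) c → (hilbertOp m E).toSeminorm (Z z) ≤ D →
      mixedNorm κ' (aF z) ≤ R → ‖g z‖ = (D * R)⁻¹ * c⁻¹ →
      ∑ j, F.toSeminorm (h j z) ^ (1 / κ') ≤ 1 := by
    intro E F κ' c z hκp hc hmix hZz haz hgz
    have h1 := mixBound_op_iff.1 hmix m n (Z z) (aF z)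
    have h2 : (∑ j, F.toSeminorm (T (Z z (aF z j))) ^ (1 / κ')) ^ κ' ≤ c * D * R :=
      h1.trans (mul_le_mul (mul_le_mul_of_nonneg_left hZz hc.le) haz (norm_nonneg _)
        (by positivity))
    have hS0 : 0 ≤ ∑ j, F.toSeminorm (T (Z z (aF z j))) ^ (1 / κ') :=
      Finset.sum_nonneg fun j _ => Real.rpow_nonneg (apply_nonneg _ _) _
    have h3 : ∑ j, F.toSeminorm (T (Z z (aF z j))) ^ (1 / κ') ≤ (c * D * R) ^ (1 / κ') := by
      have := Real.rpow_le_rpow (Real.rpow_nonneg hS0 _) h2 (one_div_pos.2 hκp).le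
      rwa [← Real.rpow_mul hS0, mul_one_div_cancel hκp.ne', Real.rpow_one] at this
    have h4 : ∀ j, F.toSeminorm (h j z) ^ (1 / κ') =
        ((c * D * R) ^ (1 / κ'))⁻¹ * F.toSeminorm (T (Z z (aF z j))) ^ (1 / κ') := fun j => by
      have h5 : (D * R)⁻¹ * c⁻¹ = (c * D * R)⁻¹ := by
        field_simp
      rw [hh]
      simp only
      rw [map_smul_eq_mul, hgz, h5, Real.mul_rpow (by positivity) (apply_nonneg _ _),
        Real.inv_rpow (by positivity)]
    simp_rw [h4]
    rw [← Finset.mul_sum, inv_mul_le_iff₀ (by positivity), mul_one]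
    exact h3
  have hmain := interp_lp_le hadm hκ₀ hκ₁ hκ hκ'
    (fun t => hbdry E₀ F₀ _ hκ₀.1 hc₀ h₀ ((hZ.le_left t).trans hZD) (hmono fun k => hA₀ k t) (by
      rw [hgn]
      simp [Real.exp_neg, Real.exp_log hc₀]))
    (fun t => hbdry E₁ F₁ _ hκ₁.1 hc₁ h₁ ((hZ.le_right t).trans hZD) (hmono fun k => hA₁ k t) (by
      rw [hgn]
      simp [Real.exp_neg, Real.exp_log hc₁]))
  set P := c₀ ^ (1 - (θ : ℝ)) * c₁ ^ (θ : ℝ) * D * R with hP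
  have hPpos : 0 < P := by positivity
  have hgθ : ‖g ((θ : ℝ) : ℂ)‖ = P⁻¹ := by
    rw [hgn, Complex.ofReal_re, Real.exp_add, hP, Real.rpow_def_of_pos hc₀,
      Real.rpow_def_of_pos hc₁, mul_neg, mul_neg, Real.exp_neg, Real.exp_neg,
      mul_comm (1 - (θ : ℝ)), mul_comm (θ : ℝ)]
    have := Real.exp_pos (Real.log c₀ * (1 - (θ : ℝ)))
    have := Real.exp_pos (Real.log c₁ * (θ : ℝ))
    field_simp
  have hint : ∀ j, interpFun θ F₀ F₁ (h j ((θ : ℝ) : ℂ)) =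
      P⁻¹ * interpFun θ F₀ F₁ (T (Z ((θ : ℝ) : ℂ) (a j))) := fun j => by
    have := map_smul_eq_mul (interp θ F₀ F₁).toSeminorm (g ((θ : ℝ) : ℂ))
      (T (Z ((θ : ℝ) : ℂ) (aF ((θ : ℝ) : ℂ) j)))
    rw [hgθ, haθ] at this
    rw [hh]
    simp only [haθ]
    exact this
  simp_rw [hint, Real.mul_rpow (inv_nonneg.2 hPpos.le) (interpFun_nonneg _ _ _ _)] at hmain
  rw [← Finset.mul_sum, Real.mul_rpow (by positivity)
    (Finset.sum_nonneg fun j _ => Real.rpow_nonneg (interpFun_nonneg _ _ _ _) _),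
    ← Real.rpow_mul (inv_nonneg.2 hPpos.le), one_div_mul_cancel hκ'.1.ne', Real.rpow_one,
    inv_mul_le_iff₀ hPpos, mul_one] at hmain
  exact hmain

theorem eq_zero_of_mixedNorm_eq_zero {κ : ℝ} (hκ : 0 < κ) {m n : ℕ}
    {a : Fin n → EuclideanSpace ℂ (Fin m)} (h : mixedNorm κ a = 0) (j : Fin n) : a j = 0 := by
  have h1 := norm_eq_zero.1 h
  ext k
  have h2 : (∑ j, ‖a j k‖ ^ (1 / κ)) ^ κ = 0 := congrFun (congrArg WithLp.ofLp h1) k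
  have h3 := (Real.rpow_eq_zero (Finset.sum_nonneg fun j _ => by positivity) hκ.ne').1 h2
  have h4 := (Finset.sum_eq_zero_iff_of_nonneg fun j _ => by positivity).1 h3 j
    (Finset.mem_univ j)
  have h5 := (Real.rpow_eq_zero (norm_nonneg _) (one_div_pos.2 hκ).ne').1 h4
  simpa using h5

theorem interp_mixBound_of_pos [FiniteDimensional ℂ V] [FiniteDimensional ℂ W]
    {E₀ E₁ : CNorm V} {F₀ F₁ : CNorm W} {θ : unitInterval} {κ₀ κ₁ κ c₀ c₁ : ℝ}
    (hκ₀ : κ₀ ∈ Set.Ioc (0 : ℝ) 1) (hκ₁ : κ₁ ∈ Set.Ioc (0 : ℝ) 1)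
    (hκ : κ = (1 - (θ : ℝ)) * κ₀ + (θ : ℝ) * κ₁) (hκ' : κ ∈ Set.Ioc (0 : ℝ) 1)
    (hc₀ : 0 < c₀) (hc₁ : 0 < c₁) {T : V →ₗ[ℂ] W} (h₀ : MixBound κ₀ (op T E₀ F₀) c₀)
    (h₁ : MixBound κ₁ (op T E₁ F₁) c₁) {m n : ℕ} (X : EuclideanSpace ℂ (Fin m) →ₗ[ℂ] V)
    (a : Fin n → EuclideanSpace ℂ (Fin m)) :
    (∑ j, interpFun θ F₀ F₁ (T (X (a j))) ^ (1 / κ)) ^ κ ≤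
      c₀ ^ (1 - (θ : ℝ)) * c₁ ^ (θ : ℝ) *
        (dNorm θ E₀ E₁ m * (hilbertOp m (interp θ E₀ E₁)).toSeminorm X) * mixedNorm κ a := by
  -- Here the constant d_θ enters, as the norm of the identity between the two norms on the space of
  -- operators.
  have hX : interpFun θ (hilbertOp m E₀) (hilbertOp m E₁) X ≤
      dNorm θ E₀ E₁ m * (hilbertOp m (interp θ E₀ E₁)).toSeminorm X :=
    (op (LinearMap.id : (EuclideanSpace ℂ (Fin m) →ₗ[ℂ] V) →ₗ[ℂ] _)
      (hilbertOp m (interp θ E₀ E₁)) (interp θ (hilbertOp m E₀) (hilbertOp m E₁))).le_opNorm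
      ((hilbertOp m (interp θ E₀ E₁)).toSpace X)
  set D₀ := dNorm θ E₀ E₁ m * (hilbertOp m (interp θ E₀ E₁)).toSeminorm X with hD₀
  have hD₀0 : 0 ≤ D₀ := (interpFun_nonneg _ _ _ _).trans hX
  have hR : 0 ≤ mixedNorm κ a := norm_nonneg _
  -- The normalising function divides by the mixed norm, so a = 0 is treated apart; the ε below is
  -- needed because the interpolation norm is an infimum.
  rcases hR.eq_or_lt with h0 | hRpos
  · have h1 : ∀ j, interpFun θ F₀ F₁ (T (X (a j))) = 0 := fun j => by
      rw [eq_zero_of_mixedNorm_eq_zero hκ'.1 h0.symm j, map_zero, map_zero]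
      exact map_zero (interp θ F₀ F₁).toSeminorm
    simp only [h1, Real.zero_rpow (one_div_pos.2 hκ'.1).ne', Finset.sum_const_zero,
      Real.zero_rpow hκ'.1.ne']
    positivity
  · have key : ∀ ε : ℝ, 0 < ε → (∑ j, interpFun θ F₀ F₁ (T (X (a j))) ^ (1 / κ)) ^ κ ≤
        c₀ ^ (1 - (θ : ℝ)) * c₁ ^ (θ : ℝ) * (D₀ + ε) * mixedNorm κ a := by
      intro ε hε
      obtain ⟨Z, hZ, rfl, hZD⟩ := exists_stripNorm_lt (hX.trans_lt (lt_add_of_pos_right D₀ hε))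
      exact interp_mixBound_aux hκ₀ hκ₁ hκ hκ' hc₀ hc₁ h₀ h₁ hZ (by linarith) hZD.le a hRpos
    have hlim : Tendsto (fun ε : ℝ => c₀ ^ (1 - (θ : ℝ)) * c₁ ^ (θ : ℝ) * (D₀ + ε) *
        mixedNorm κ a) (𝓝[>] 0)
        (𝓝 (c₀ ^ (1 - (θ : ℝ)) * c₁ ^ (θ : ℝ) * (D₀ + 0) * mixedNorm κ a)) := by
      have hcont : Continuous fun ε : ℝ => c₀ ^ (1 - (θ : ℝ)) * c₁ ^ (θ : ℝ) * (D₀ + ε) *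
        mixedNorm κ a := by fun_prop
      exact (hcont.tendsto 0).mono_left nhdsWithin_le_nhds
    rw [add_zero] at hlim
    refine ge_of_tendsto hlim ?_
    filter_upwards [self_mem_nhdsWithin] with ε hε using key ε hε

/-- Vanishing c_i, excluded so far by their logarithms, are reached by enlarging both constants to
c_i + ε and letting ε → 0; the powers are continuous at 0 since their exponents are nonnegative. -/
theorem interp_mixBound [FiniteDimensional ℂ V] [FiniteDimensional ℂ W]
    {E₀ E₁ : CNorm V} {F₀ F₁ : CNorm W} {θ : unitInterval} {κ₀ κ₁ κ c₀ c₁ : ℝ}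
    (hκ₀ : κ₀ ∈ Set.Ioc (0 : ℝ) 1) (hκ₁ : κ₁ ∈ Set.Ioc (0 : ℝ) 1)
    (hκ : κ = (1 - (θ : ℝ)) * κ₀ + (θ : ℝ) * κ₁) (hκ' : κ ∈ Set.Ioc (0 : ℝ) 1)
    (hc₀ : 0 ≤ c₀) (hc₁ : 0 ≤ c₁) {T : V →ₗ[ℂ] W} (h₀ : MixBound κ₀ (op T E₀ F₀) c₀)
    (h₁ : MixBound κ₁ (op T E₁ F₁) c₁) {m n : ℕ} (X : EuclideanSpace ℂ (Fin m) →ₗ[ℂ] V)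
    (a : Fin n → EuclideanSpace ℂ (Fin m)) :
    (∑ j, interpFun θ F₀ F₁ (T (X (a j))) ^ (1 / κ)) ^ κ ≤
      c₀ ^ (1 - (θ : ℝ)) * c₁ ^ (θ : ℝ) *
        (dNorm θ E₀ E₁ m * (hilbertOp m (interp θ E₀ E₁)).toSeminorm X) * mixedNorm κ a := by
  have hθ0 : 0 ≤ (θ : ℝ) := θ.2.1
  have hθ1 : 0 ≤ 1 - (θ : ℝ) := by linarith [θ.2.2]
  have hlim : Tendsto (fun ε : ℝ => (c₀ + ε) ^ (1 - (θ : ℝ)) * (c₁ + ε) ^ (θ : ℝ) *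
      (dNorm θ E₀ E₁ m * (hilbertOp m (interp θ E₀ E₁)).toSeminorm X) * mixedNorm κ a) (𝓝[>] 0)
      (𝓝 ((c₀ + 0) ^ (1 - (θ : ℝ)) * (c₁ + 0) ^ (θ : ℝ) *
      (dNorm θ E₀ E₁ m * (hilbertOp m (interp θ E₀ E₁)).toSeminorm X) * mixedNorm κ a)) := by
    have hcont : Continuous fun ε : ℝ => (c₀ + ε) ^ (1 - (θ : ℝ)) * (c₁ + ε) ^ (θ : ℝ) *
      (dNorm θ E₀ E₁ m * (hilbertOp m (interp θ E₀ E₁)).toSeminorm X) * mixedNorm κ a :=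
      ((((continuous_const.add continuous_id).rpow_const fun _ => Or.inr hθ1).mul
        ((continuous_const.add continuous_id).rpow_const fun _ => Or.inr hθ0)).mul
        continuous_const).mul continuous_const
    exact (hcont.tendsto 0).mono_left nhdsWithin_le_nhds
  rw [add_zero, add_zero] at hlim
  refine ge_of_tendsto hlim ?_
  filter_upwards [self_mem_nhdsWithin] with ε hε
  have hε' : 0 < ε := hε
  exact interp_mixBound_of_pos hκ₀ hκ₁ hκ hκ' (by linarith) (by linarith)
    (h₀.mono (by linarith)) (h₁.mono (by linarith)) X a

end CNorm

/-! ### Arithmetic of the exponents, and the conclusion in `ℝ≥0∞`. -/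

theorem conjInv_interpolate {θ : unitInterval} {s₀ s₁ sθ : ℝ≥0∞} (hs₀ : 2 ≤ s₀) (hs₁ : 2 ≤ s₁)
    (hsθ : sθ⁻¹ = ENNReal.ofReal (1 - (θ : ℝ)) * s₀⁻¹ + ENNReal.ofReal (θ : ℝ) * s₁⁻¹) :
    conjInv sθ = (1 - (θ : ℝ)) * conjInv s₀ + (θ : ℝ) * conjInv s₁ := by
  have h0 : s₀⁻¹ ≠ ∞ := ENNReal.inv_ne_top.2 (two_pos.trans_le hs₀).ne'
  have h1 : s₁⁻¹ ≠ ∞ := ENNReal.inv_ne_top.2 (two_pos.trans_le hs₁).ne'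
  rw [conjInv, hsθ, ENNReal.toReal_add (ENNReal.mul_ne_top ENNReal.ofReal_ne_top h0)
    (ENNReal.mul_ne_top ENNReal.ofReal_ne_top h1), ENNReal.toReal_mul, ENNReal.toReal_mul,
    ENNReal.toReal_ofReal (by linarith [θ.2.2]), ENNReal.toReal_ofReal θ.2.1, conjInv, conjInv]
  ring

theorem two_le_of_interpolate {θ : unitInterval} {s₀ s₁ sθ : ℝ≥0∞} (hs₀ : 2 ≤ s₀) (hs₁ : 2 ≤ s₁)
    (hsθ : sθ⁻¹ = ENNReal.ofReal (1 - (θ : ℝ)) * s₀⁻¹ + ENNReal.ofReal (θ : ℝ) * s₁⁻¹) :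
    2 ≤ sθ := by
  rw [← ENNReal.inv_le_inv, hsθ]
  calc ENNReal.ofReal (1 - (θ : ℝ)) * s₀⁻¹ + ENNReal.ofReal (θ : ℝ) * s₁⁻¹
      ≤ ENNReal.ofReal (1 - (θ : ℝ)) * 2⁻¹ + ENNReal.ofReal (θ : ℝ) * 2⁻¹ := by gcongr
    _ = 2⁻¹ := by
      rw [← add_mul, ← ENNReal.ofReal_add (by linarith [θ.2.2]) θ.2.1]
      simp

end

theorem mainTheorem1 {V : Type u} {W : Type v}
    [AddCommGroup V] [Module ℂ V] [FiniteDimensional ℂ V]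
    [AddCommGroup W] [Module ℂ W] [FiniteDimensional ℂ W]
    (E₀ E₁ : CNorm V) (F₀ F₁ : CNorm W) (θ : unitInterval)
    (s₀ s₁ sθ : ℝ≥0∞) (hs₀ : 2 ≤ s₀) (hs₁ : 2 ≤ s₁)
    (hsθ : sθ⁻¹ = ENNReal.ofReal (1 - (θ : ℝ)) * s₀⁻¹ + ENNReal.ofReal (θ : ℝ) * s₁⁻¹)
    (T : V →ₗ[ℂ] W) :
    mixingNorm sθ 2 (CNorm.op T (CNorm.interp θ E₀ E₁) (CNorm.interp θ F₀ F₁)) ≤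
      CNorm.dConst θ E₀ E₁ * mixingNorm s₀ 2 (CNorm.op T E₀ F₀) ^ (1 - (θ : ℝ)) *
        mixingNorm s₁ 2 (CNorm.op T E₁ F₁) ^ (θ : ℝ) := by
  have hs := two_le_of_interpolate hs₀ hs₁ hsθ
  have hθ0 : 0 ≤ (θ : ℝ) := θ.2.1
  have hθ1 : 0 ≤ 1 - (θ : ℝ) := by linarith [θ.2.2]
  -- Both mixing norms on the right are finite, so the real-valued interpolation theorem applies
  -- without loss.
  have hμ₀ := mixingNorm_ne_top hs₀ (CNorm.op T E₀ F₀)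
  have hμ₁ := mixingNorm_ne_top hs₁ (CNorm.op T E₁ F₁)
  set c₀ := (mixingNorm s₀ 2 (CNorm.op T E₀ F₀)).toReal with hc₀
  set c₁ := (mixingNorm s₁ 2 (CNorm.op T E₁ F₁)).toReal with hc₁
  have hc₀0 : 0 ≤ c₀ := ENNReal.toReal_nonneg
  have hc₁0 : 0 ≤ c₁ := ENNReal.toReal_nonneg
  have key := fun (m n : ℕ) => CNorm.interp_mixBound (E₀ := E₀) (E₁ := E₁) (F₀ := F₀) (F₁ := F₁)
    (m := m) (n := n) (conjInv_mem hs₀) (conjInv_mem hs₁) (conjInv_interpolate hs₀ hs₁ hsθ)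
    (conjInv_mem hs) hc₀0 hc₁0
    (MixBound.of_mixingNorm_le hs₀ hc₀0 (ENNReal.ofReal_toReal hμ₀).ge)
    (MixBound.of_mixingNorm_le hs₁ hc₁0 (ENNReal.ofReal_toReal hμ₁).ge)
  set p := c₀ ^ (1 - (θ : ℝ)) * c₁ ^ (θ : ℝ) with hp
  have hp0 : 0 ≤ p := by positivity
  have hprod : CNorm.dConst θ E₀ E₁ * mixingNorm s₀ 2 (CNorm.op T E₀ F₀) ^ (1 - (θ : ℝ)) *
      mixingNorm s₁ 2 (CNorm.op T E₁ F₁) ^ (θ : ℝ) =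
      CNorm.dConst θ E₀ E₁ * ENNReal.ofReal p := by
    rw [mul_assoc, hp, ENNReal.ofReal_mul (by positivity),
      ← ENNReal.ofReal_rpow_of_nonneg hc₀0 hθ1, ← ENNReal.ofReal_rpow_of_nonneg hc₁0 hθ0, hc₀,
      hc₁, ENNReal.ofReal_toReal hμ₀, ENNReal.ofReal_toReal hμ₁]
  rw [hprod]
  have hdm : ∀ m, ENNReal.ofReal (CNorm.dNorm θ E₀ E₁ m) ≤ CNorm.dConst θ E₀ E₁ := fun m =>
    le_iSup (fun m => ENNReal.ofReal (CNorm.dNorm θ E₀ E₁ m)) m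
  have hbound : ∀ C : ℝ, 0 ≤ C → (∀ m, p * CNorm.dNorm θ E₀ E₁ m ≤ C) →
      mixingNorm sθ 2 (CNorm.op T (CNorm.interp θ E₀ E₁) (CNorm.interp θ F₀ F₁)) ≤
        ENNReal.ofReal C := by
    intro C hC h
    refine MixBound.mixingNorm_le hs hC (CNorm.mixBound_op_iff.2 fun m n X a => ?_)
    refine (key m n X a).trans (mul_le_mul_of_nonneg_right ?_ (norm_nonneg _))
    rw [← mul_assoc]
    exact mul_le_mul_of_nonneg_right (h m) (apply_nonneg _ _)
  -- When d_θ = ∞ and p = 0 the right side is ∞ · 0 = 0, so the bound has content: each m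
  -- contributes p · `dNorm` = 0.
  rcases eq_or_ne (CNorm.dConst θ E₀ E₁) ∞ with hd | hd
  · rcases hp0.eq_or_lt with h0 | hpos
    · refine (hbound 0 le_rfl fun m => ?_).trans (by simp)
      rw [← h0, zero_mul]
    · rw [hd, ENNReal.top_mul (by simpa using hpos)]
      exact le_top
  · refine (hbound ((CNorm.dConst θ E₀ E₁).toReal * p) (by positivity) fun m => ?_).trans ?_
    · rw [mul_comm]
      exact mul_le_mul_of_nonneg_right ((ENNReal.ofReal_le_iff_le_toReal hd).1 (hdm m)) hp0
    · rw [ENNReal.ofReal_mul ENNReal.toReal_nonneg, ENNReal.ofReal_toReal hd]
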